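/- A co-Heyting algebra is a bounded lattice with an operation $-$ such that $a-b\le c\iff a\le b\vee c$ for all $a,b,c$ (i.e. $a-b$ is the least $c$ with $a\le b\vee c$); it is viewed as a structure in the language $\{\mathbf 0,\mathbf 1,\vee,\wedge,-\}$. Write $b\ll a$ if $a-b=a\ge b$. Let $\mathcal V_3$ be the variety of co-Heyting algebras of dimension $\le 1$ (dual to Hosoi's second slice), i.e. those satisfying $\big(((\mathbf 1-x)\wedge x)-y\big)\wedge y=\mathbf 0$ for all $x,y$. Theorem. The theory of $\mathcal V_3$ has a model completion, and it is axiomatised by the axioms of $\mathcal V_3$ together with the following two axioms: (D3) for every $a$ with $a=\mathbf 1-(\mathbf 1-a)\neq\mathbf 0$ there is $b\neq\mathbf 0$ with $b\ll a$; (S3) for all $a,b_1,b_2$ with $b_1\vee b_2\ll a\neq\mathbf 0$ there are nonzero $a_1,a_2$ with $a-a_2=a_1\ge b_1$, $a-a_1=a_2\ge b_2$ and $a_1\wedge a_2=b_1\wedge b_2$. That is: an algebra is a model of the axioms of $\mathcal V_3$, (D3) and (S3) if and only if it is an existentially closed algebra of $\mathcal V_3$, and the theory given by these axioms eliminates quantifiers.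 -/

import Mathlib

open FirstOrder FirstOrder.Language

universe u

/-! ## Model companions and model completions -/

namespace ModelCompletion

variable {L : FirstOrder.Language.{0, 0}}

/-- `M` is an existentially closed model of `T`: it is a model of `T`, and every existential
formula with parameters in `M` which holds in some model of `T` extending `M` already holds
in `M`. -/
def IsExistentiallyClosed (T : L.Theory) (M : Type u) [L.Structure M] : Prop :=
  M ⊨ T ∧
    ∀ (N : Type u) [L.Structure N], N ⊨ T → ∀ (f : M ↪[L] N) (m n : ℕ)
      (φ : L.Formula (Fin m ⊕ Fin n)), BoundedFormula.IsQF φ → ∀ a : Fin m → M,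
        (∃ b : Fin n → N, φ.Realize (Sum.elim (f ∘ a) b)) →
          ∃ b : Fin n → M, φ.Realize (Sum.elim a b)

/-- `T'` is (an axiomatisation of) the model companion of the universal theory `T`: the models of
`T'` are exactly the existentially closed models of `T`. -/
def IsModelCompanion (T : L.Theory) [T.IsUniversal] (T' : L.Theory) : Prop :=
  ∀ (M : Type u) [L.Structure M] [Nonempty M], M ⊨ T' ↔ IsExistentiallyClosed T M

/-- `T` eliminates quantifiers: every formula in finitely many free variables (possibly none) is
equivalent modulo `T` to a quantifier-free formula in the same free variables. -/
def HasQuantifierElimination (T : L.Theory) : Prop :=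
  ∀ (n : ℕ) (φ : L.Formula (Fin n)), ∃ ψ : L.Formula (Fin n), BoundedFormula.IsQF ψ ∧ φ ⇔[T] ψ

/-- `T'` is (an axiomatisation of) the model completion of the universal theory `T`: it is the
model companion of `T`, and it eliminates quantifiers. -/
def IsModelCompletion (T : L.Theory) [T.IsUniversal] (T' : L.Theory) : Prop :=
  IsModelCompanion.{u} T T' ∧ HasQuantifierElimination T'

end ModelCompletion

/-! ## The language of co-Heyting algebras -/

namespace CoHeyting

/-- The function symbols `0`, `1`, `∨`, `∧`, `-`. -/
inductive Func : ℕ → Type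
  | bot : Func 0
  | top : Func 0
  | sup : Func 2
  | inf : Func 2
  | sdiff : Func 2

/-- The language `{0, 1, ∨, ∧, -}` of co-Heyting algebras, without relation symbols. -/
def lang : FirstOrder.Language.{0, 0} := ⟨Func, fun _ => Empty⟩

/-! Terms and formulas, written with the usual symbols. -/

instance {α : Type} : Bot (lang.Term α) := ⟨Constants.term (L := lang) Func.bot⟩
instance {α : Type} : Top (lang.Term α) := ⟨Constants.term (L := lang) Func.top⟩
instance {α : Type} : Max (lang.Term α) := ⟨Functions.apply₂ (L := lang) Func.sup⟩
instance {α : Type} : Min (lang.Term α) := ⟨Functions.apply₂ (L := lang) Func.inf⟩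
instance {α : Type} : SDiff (lang.Term α) := ⟨Functions.apply₂ (L := lang) Func.sdiff⟩

/-- The formula `s ≤ t`, i.e. `s ∨ t = t`. -/
def fle {n : ℕ} (s t : lang.Term (Empty ⊕ Fin n)) : lang.BoundedFormula Empty n :=
  (s ⊔ t) =' t

/-- The formula `s ≠ 0`. -/
def fne {n : ℕ} (s : lang.Term (Empty ⊕ Fin n)) : lang.BoundedFormula Empty n :=
  ∼(s =' ⊥)

/-- The formula `s ≪ t`, i.e. `t - s = t` and `s ≤ t`. -/
def fll {n : ℕ} (s t : lang.Term (Empty ⊕ Fin n)) : lang.BoundedFormula Empty n :=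
  ((t \ s) =' t) ⊓ fle s t

/-! ## The theories -/

/-- The lattice axioms (commutativity, associativity, absorption). -/
def latticeAxioms : lang.Theory :=
  { ∀' ∀' ((&0 ⊔ &1) =' (&1 ⊔ &0)),
    ∀' ∀' ((&0 ⊓ &1) =' (&1 ⊓ &0)),
    ∀' ∀' ∀' (((&0 ⊔ &1) ⊔ &2) =' (&0 ⊔ (&1 ⊔ &2))),
    ∀' ∀' ∀' (((&0 ⊓ &1) ⊓ &2) =' (&0 ⊓ (&1 ⊓ &2))),
    ∀' ∀' ((&0 ⊔ (&0 ⊓ &1)) =' &0),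
    ∀' ∀' ((&0 ⊓ (&0 ⊔ &1)) =' &0) }

/-- The theory of co-Heyting algebras: bounded lattices in which `a - b` is the least `c` with
`a ≤ b ∨ c`, that is, `a - b ≤ c ↔ a ≤ b ∨ c`. (Distributivity follows.) -/
def theoryV1 : lang.Theory :=
  latticeAxioms ∪
  { ∀' fle ⊥ &0,
    ∀' fle &0 ⊤,
    ∀' ∀' ∀' ((fle (&0 \ &1) &2).iff (fle &0 (&1 ⊔ &2))) }

/-- The theory of the variety `𝒱₃` of co-Heyting algebras of dimension at most one, given within
co-Heyting algebras by the equation `(((1 - x) ∧ x) - y) ∧ y = 0`. -/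
def theoryV3 : lang.Theory :=
  theoryV1 ∪ { ∀' ∀' (((((⊤ \ &0) ⊓ &0) \ &1) ⊓ &1) =' ⊥) }

/-- Density D3: for every `a` with `a = 1 - (1 - a) ≠ 0` there is `b ≠ 0` with `b ≪ a`. -/
def densityD3 : lang.Sentence :=
  ∀' (((&0 =' (⊤ \ (⊤ \ &0))) ⊓ fne &0) ⟹ ∃' (fne &1 ⊓ fll &1 &0))

/-- Splitting S3 (the same as S1): for all `a, b₁, b₂` with `b₁ ∨ b₂ ≪ a ≠ 0` there are nonzero
`a₁, a₂` with `a - a₂ = a₁ ≥ b₁`, `a - a₁ = a₂ ≥ b₂` and `a₁ ∧ a₂ = b₁ ∧ b₂`.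
The variables `0, 1, 2, 3, 4` stand for `a, b₁, b₂, a₁, a₂`. -/
def splittingS3 : lang.Sentence :=
  ∀' ∀' ∀' ((fll (&1 ⊔ &2) &0 ⊓ fne &0) ⟹
    ∃' ∃' (fne &3 ⊓ (fne &4 ⊓
      ((((&0 \ &4) =' &3) ⊓ fle &1 &3) ⊓
        ((((&0 \ &3) =' &4) ⊓ fle &2 &4) ⊓
          ((&3 ⊓ &4) =' (&1 ⊓ &2)))))))

/-- The axioms of `𝒱₃` are universal sentences. -/
instance : theoryV3.IsUniversal := by
  refine ⟨fun φ hφ => ?_⟩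
  simp only [theoryV3, theoryV1, latticeAxioms, Set.mem_union, Set.mem_insert_iff,
    Set.mem_singleton_iff] at hφ
  rcases hφ with ((h | h | h | h | h | h) | h | h | h) | h <;> subst h <;>
    repeat' first
      | exact BoundedFormula.IsQF.isUniversal (BoundedFormula.IsAtomic.equal _ _).isQF
      | exact BoundedFormula.IsQF.isUniversal
          (((BoundedFormula.IsAtomic.equal _ _).isQF.imp
              (BoundedFormula.IsAtomic.equal _ _).isQF).inf
            ((BoundedFormula.IsAtomic.equal _ _).isQF.imp
              (BoundedFormula.IsAtomic.equal _ _).isQF))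
      | apply BoundedFormula.IsUniversal.all

/-! ## Meaning of the theories in Mathlib's co-Heyting algebras -/

/-- A co-Heyting algebra as a structure for the language. -/
@[reducible] def toStructure (M : Type u) [CoheytingAlgebra M] : lang.Structure M where
  funMap := fun {_} f => match f with
    | .bot => fun _ => ⊥
    | .top => fun _ => ⊤
    | .sup => fun x => x 0 ⊔ x 1
    | .inf => fun x => x 0 ⊓ x 1
    | .sdiff => fun x => x 0 \ x 1
  RelMap := fun r => r.elim

section Realize

variable {M : Type u} [CoheytingAlgebra M] {α : Type} (v : α → M)

attribute [local instance] toStructure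

theorem realize_bot : (⊥ : lang.Term α).realize v = ⊥ := rfl
theorem realize_top : (⊤ : lang.Term α).realize v = ⊤ := rfl
theorem realize_sup (s t : lang.Term α) :
    (s ⊔ t).realize v = s.realize v ⊔ t.realize v := rfl
theorem realize_inf (s t : lang.Term α) :
    (s ⊓ t).realize v = s.realize v ⊓ t.realize v := rfl
theorem realize_sdiff (s t : lang.Term α) :
    (s \ t).realize v = s.realize v \ t.realize v := rfl

variable (M)

theorem models_V3_iff :
    M ⊨ theoryV3 ↔ ∀ x y : M, (((⊤ \ x) ⊓ x) \ y) ⊓ y = ⊥ := by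
  simp [theoryV3, theoryV1, latticeAxioms, Theory.model_iff, or_imp, forall_and,
    Sentence.Realize, Formula.Realize, fle, realize_bot, realize_top, realize_sup, realize_inf,
    realize_sdiff, Fin.snoc, sup_comm, inf_comm, -top_sdiff']
  exact ⟨fun _ a b c => by rw [sup_left_comm, sup_comm c, sup_left_comm],
    fun _ a b c => by rw [inf_left_comm, inf_comm c, inf_left_comm]⟩

theorem models_D3_iff :
    M ⊨ densityD3 ↔ ∀ a : M, a = ⊤ \ (⊤ \ a) ∧ a ≠ ⊥ →
      ∃ b : M, b ≠ ⊥ ∧ a \ b = a ∧ b ≤ a := by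
  simp [densityD3, Sentence.Realize, Formula.Realize, fne, fll, fle, realize_bot, realize_top,
    realize_sup, realize_sdiff, Fin.snoc]

theorem models_S3_iff :
    M ⊨ splittingS3 ↔ ∀ a b₁ b₂ : M, (a \ (b₁ ⊔ b₂) = a ∧ b₁ ⊔ b₂ ≤ a) ∧ a ≠ ⊥ →
      ∃ a₁ a₂ : M, a₁ ≠ ⊥ ∧ a₂ ≠ ⊥ ∧ (a \ a₂ = a₁ ∧ b₁ ≤ a₁) ∧ (a \ a₁ = a₂ ∧ b₂ ≤ a₂) ∧
        a₁ ⊓ a₂ = b₁ ⊓ b₂ := by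
  simp only [splittingS3, Sentence.Realize, Formula.Realize, fne, fll, fle, realize_sup,
    realize_inf, realize_sdiff, realize_bot, BoundedFormula.realize_all, BoundedFormula.realize_ex,
    BoundedFormula.realize_imp, BoundedFormula.realize_inf, BoundedFormula.realize_not,
    BoundedFormula.realize_bdEqual, sup_eq_right, ne_eq]
  exact Iff.rfl

end Realize

/-- Every model of `theoryV1` is a co-Heyting algebra in Mathlib's sense. -/
theorem exists_coheyting (M : Type u) [S : lang.Structure M] (h : M ⊨ theoryV1) :
    ∃ A : CoheytingAlgebra M, @toStructure M A = S := by
  simp only [theoryV1, latticeAxioms, Theory.model_iff, Set.mem_union, Set.mem_insert_iff,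
    Set.mem_singleton_iff, or_imp, forall_and, forall_eq] at h
  obtain ⟨⟨h1, h2, h3, h4, h5, h6⟩, h7, h8, h9⟩ := h
  let b : M := S.funMap Func.bot ![]
  let t : M := S.funMap Func.top ![]
  let j : M → M → M := fun x y => S.funMap Func.sup ![x, y]
  let m : M → M → M := fun x y => S.funMap Func.inf ![x, y]
  let d : M → M → M := fun x y => S.funMap Func.sdiff ![x, y]
  have eb : ∀ {α : Type} (v : α → M), (⊥ : lang.Term α).realize v = b :=
    fun v => Term.realize_constants.trans (congrArg (S.funMap Func.bot) (Subsingleton.elim _ _))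
  have et : ∀ {α : Type} (v : α → M), (⊤ : lang.Term α).realize v = t :=
    fun v => Term.realize_constants.trans (congrArg (S.funMap Func.top) (Subsingleton.elim _ _))
  have ej : ∀ {α : Type} (v : α → M) (x y : lang.Term α),
      (x ⊔ y).realize v = j (x.realize v) (y.realize v) :=
    fun v x y => Term.realize_functions_apply₂
  have em : ∀ {α : Type} (v : α → M) (x y : lang.Term α),
      (x ⊓ y).realize v = m (x.realize v) (y.realize v) :=
    fun v x y => Term.realize_functions_apply₂
  have ed : ∀ {α : Type} (v : α → M) (x y : lang.Term α),
      (x \ y).realize v = d (x.realize v) (y.realize v) :=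
    fun v x y => Term.realize_functions_apply₂
  simp only [Sentence.Realize, Formula.Realize, fle, BoundedFormula.realize_all,
    BoundedFormula.realize_iff, BoundedFormula.realize_bdEqual, eb, et, ej, em, ed] at h1 h2 h3 h4 h5 h6 h7 h8 h9
  change ∀ x y, j x y = j y x at h1
  change ∀ x y, m x y = m y x at h2
  change ∀ x y z, j (j x y) z = j x (j y z) at h3
  change ∀ x y z, m (m x y) z = m x (m y z) at h4
  change ∀ x y, j x (m x y) = x at h5
  change ∀ x y, m x (j x y) = x at h6
  change ∀ x, j b x = x at h7
  change ∀ x, j x t = t at h8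
  change ∀ x y z, j (d x y) z = z ↔ j x (j y z) = j y z at h9
  let _ : Max M := ⟨j⟩
  let _ : Min M := ⟨m⟩
  let _ : Lattice M := Lattice.mk' h1 h3 h2 h4 h5 h6
  have le_iff : ∀ x y : M, x ≤ y ↔ j x y = y := fun x y => sup_eq_right.symm
  let A : CoheytingAlgebra M :=
    { (inferInstance : Lattice M) with
      bot := b
      top := t
      bot_le := fun x => (le_iff _ _).2 (h7 x)
      le_top := fun x => (le_iff _ _).2 (h8 x)
      sdiff := d
      hnot := fun x => d t x
      sdiff_le_iff := fun x y z => (le_iff _ _).trans ((h9 x y z).trans (le_iff _ _).symm)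
      top_sdiff := fun _ => rfl }
  refine ⟨A, ?_⟩
  refine Structure.ext ?_ ?_
  · funext n f x
    cases f with
    | bot => exact congrArg (S.funMap Func.bot) (Subsingleton.elim _ _)
    | top => exact congrArg (S.funMap Func.top) (Subsingleton.elim _ _)
    | sup => exact congrArg (S.funMap Func.sup) (List.ofFn_inj.1 rfl)
    | inf => exact congrArg (S.funMap Func.inf) (List.ofFn_inj.1 rfl)
    | sdiff => exact congrArg (S.funMap Func.sdiff) (List.ofFn_inj.1 rfl)
  · funext n r
    exact r.elim

end CoHeyting

namespace CoHeyting

/-! ## Co-Heyting algebras of dimension at most one -/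

/-! A finite co-Heyting algebra is the algebra of lower sets of its poset of join-primes. In
dimension at most one, chains of join-primes have at most two elements, so a non-maximal join-prime
is minimal. An embedding `i : A → B` of finite algebras is dual to a surjective upward p-morphism on
join-primes, namely its left adjoint `g`.

The core is `exists_extension`: if `M` satisfies (D3) and (S3), an embedding `f : A → M` extends
along `i`. By `exists_hom_of_family` it suffices to choose suitable elements of `M` indexed by the
join-primes of `B`. The non-maximal `r` receive pairwise disjoint nonzero elements below `f (g r)`:
those over a non-maximal `p` partition `f p`, and those over a maximal `p` are `≪ f p`, with (D3)
providing the room (`exists_minimal_fiber`). Each `f m` with `m` maximal is then split by iterated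
(S3) among the maximal join-primes over `m`, so that two parts meet only in what was prescribed
below both (`Splitting.exists_finset`).

Finitely generated algebras are finite (`exists_finite_closed`). Hence a quantifier-free condition
solved in an extension of `M` is solved in a finite algebra, which re-embeds into `M` over the
parameters: models of the axioms are existentially closed. The same step gives a back-and-forth
between models, and compactness turns this into quantifier elimination.

Conversely, every algebra embeds into the lower sets of a poset of depth two, its prime ideals.
Enlarging that poset yields an extension with a witness for a given instance of (D3) or (S3), and
existential closedness brings the witness back. -/

/-- The defining equation of `𝒱₃`. -/
def DimLEOne (M : Type*) [CoheytingAlgebra M] : Prop :=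
  ∀ x y : M, (((⊤ \ x) ⊓ x) \ y) ⊓ y = ⊥

/-- The density axiom (D3) for a co-Heyting algebra. -/
def Density (M : Type*) [CoheytingAlgebra M] : Prop :=
  ∀ a : M, a = ⊤ \ (⊤ \ a) ∧ a ≠ ⊥ → ∃ b : M, b ≠ ⊥ ∧ a \ b = a ∧ b ≤ a

/-- The splitting axiom (S3) for a co-Heyting algebra. -/
def Splitting (M : Type*) [CoheytingAlgebra M] : Prop :=
  ∀ a b₁ b₂ : M, (a \ (b₁ ⊔ b₂) = a ∧ b₁ ⊔ b₂ ≤ a) ∧ a ≠ ⊥ →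
    ∃ a₁ a₂ : M, a₁ ≠ ⊥ ∧ a₂ ≠ ⊥ ∧ (a \ a₂ = a₁ ∧ b₁ ≤ a₁) ∧ (a \ a₁ = a₂ ∧ b₂ ≤ a₂) ∧
      a₁ ⊓ a₂ = b₁ ⊓ b₂

section General

variable {M : Type*} [CoheytingAlgebra M]

theorem sdiff_eq_self_of_le {a x y : M} (h : a \ y = a) (hxy : x ≤ y) : a \ x = a :=
  le_antisymm sdiff_le (h.symm.le.trans (sdiff_le_sdiff_left hxy))

theorem sdiff_sup_eq_self {a x y : M} (hx : a \ x = a) (hy : a \ y = a) : a \ (x ⊔ y) = a := by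
  rw [← sdiff_sdiff, hx, hy]

theorem sdiff_finset_sup_eq_self {ι : Type*} {a : M} {s : Finset ι} {x : ι → M}
    (h : ∀ i ∈ s, a \ x i = a) : a \ s.sup x = a := by
  classical
  induction s using Finset.induction_on with
  | empty => simp
  | insert i s _ ih =>
    rw [Finset.sup_insert]
    exact sdiff_sup_eq_self (h i (by simp)) (ih fun j hj => h j (by simp [hj]))

theorem sdiff_eq_self_of_sdiff {a b x : M} (h : a \ x = a) : (a \ b) \ x = a \ b := by
  rw [sdiff_sdiff_comm, h]

theorem _root_.SupPrime.sdiff_eq_self {p x : M} (hp : SupPrime p) (h : ¬ p ≤ x) : p \ x = p :=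
  le_antisymm sdiff_le ((hp.le_sup.1 (le_sup_sdiff : p ≤ x ⊔ p \ x)).resolve_left h)

/-- In dimension at most one, chains of join-primes have at most two elements. -/
theorem DimLEOne.not_lt_lt (hM : DimLEOne M) {p q r : M} (hp : SupPrime p) (hq : SupPrime q)
    (hr : SupPrime r) (hpq : p < q) (hqr : q < r) : False := by
  have h1 : r ≤ ⊤ \ q := (hr.le_sup.1 ((le_top : r ≤ ⊤).trans
    (le_sup_sdiff : (⊤ : M) ≤ q ⊔ ⊤ \ q))).resolve_left hqr.not_ge
  have h2 : (⊤ \ q) ⊓ q = q := inf_eq_right.2 (hqr.le.trans h1)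
  have h3 := hM q p
  rw [h2, hq.sdiff_eq_self hpq.not_ge, inf_eq_right.2 hpq.le] at h3
  exact hp.ne_bot h3

/-- Something strictly above `p` and something strictly below it would form a three-element chain.
So non-maximal join-primes are minimal. -/
theorem DimLEOne.eq_of_le (hM : DimLEOne M) {p q : M} (hp : SupPrime p)
    (hpm : ¬ Maximal SupPrime p) (hq : SupPrime q) (h : q ≤ p) : q = p := by
  by_contra hne
  apply hpm
  refine ⟨hp, fun r hr hpr => ?_⟩
  by_contra hrp
  exact hM.not_lt_lt hq hp hr (lt_of_le_of_ne h hne) (lt_of_le_not_ge hpr hrp)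

/-- No finiteness is needed: whatever lies strictly above a join-prime is already maximal. -/
theorem DimLEOne.exists_maximal (hM : DimLEOne M) {p : M} (hp : SupPrime p) :
    ∃ m, Maximal SupPrime m ∧ p ≤ m := by
  by_cases h : Maximal SupPrime p
  · exact ⟨p, h, le_rfl⟩
  · by_contra! hc
    apply h
    refine ⟨hp, fun r hr hpr => ?_⟩
    by_contra hrp
    have : ¬ Maximal SupPrime r := fun hm => hc r hm hpr
    exact hrp (hM.eq_of_le hr this hp hpr).ge

theorem DimLEOne.of_injective {N : Type*} [CoheytingAlgebra N] (hN : DimLEOne N)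
    (f : CoheytingHom M N) (hf : Function.Injective f) : DimLEOne M := fun x y => hf (by
  have := hN (f x) (f y)
  rw [← map_top f] at this
  simpa only [← map_sdiff, ← map_inf, ← map_bot f] using this)

end General

/-! ### Finite algebras through their join-primes -/

section Finite

variable {B : Type*} [CoheytingAlgebra B] [Finite B]

theorem le_of_forall_supPrime {a c : B} (h : ∀ q, SupPrime q → q ≤ a → q ≤ c) : a ≤ c := by
  obtain ⟨s, rfl, hs⟩ := exists_supIrred_decomposition a
  exact Finset.sup_le fun q hq => h q (hs hq).supPrime (Finset.le_sup (f := id) hq)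

/-- Dually, `b \ c` is the down-closure of the primes in `b` and outside `c`: together with `c`
these primes cover `b`. -/
theorem _root_.SupPrime.exists_of_le_sdiff {q b c : B} (hq : SupPrime q) (h : q ≤ b \ c) :
    ∃ q', SupPrime q' ∧ q ≤ q' ∧ q' ≤ b ∧ ¬ q' ≤ c := by
  classical
  have := Fintype.ofFinite B
  let s : Finset B := Finset.univ.filter fun q' => SupPrime q' ∧ q' ≤ b ∧ ¬ q' ≤ c
  have hb : b ≤ c ⊔ s.sup id := le_of_forall_supPrime fun r hr hrb => by
    by_cases hrc : r ≤ c
    · exact le_sup_of_le_left hrc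
    · exact le_sup_of_le_right (Finset.le_sup (f := id) (by
        simp only [s, Finset.mem_filter, Finset.mem_univ, true_and]
        exact ⟨hr, hrb, hrc⟩))
  obtain ⟨q', hq', hle⟩ := hq.le_finset_sup.1 (h.trans (sdiff_le_iff.2 hb))
  simp only [s, Finset.mem_filter, Finset.mem_univ, true_and] at hq'
  exact ⟨q', hq'.1, hle, hq'.2⟩

/-- Supplies the regularity hypothesis of (D3). A maximal prime `p` is not below `⊤ \ p`, since it
would then lie under a prime not below `p`. -/
theorem eq_top_sdiff_top_sdiff {p : B} (hp : Maximal SupPrime p) : p = ⊤ \ (⊤ \ p) := by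
  refine le_antisymm ?_ (sdiff_le_iff.2 (by rw [sup_comm]; exact le_sup_sdiff))
  refine (hp.prop.le_sup.1 ((le_top : p ≤ ⊤).trans
    (le_sup_sdiff : (⊤ : B) ≤ (⊤ \ p) ⊔ ⊤ \ (⊤ \ p)))).resolve_left fun h => ?_
  obtain ⟨q, hq, hpq, -, hqp⟩ := hp.prop.exists_of_le_sdiff h
  exact hqp (hp.2 hq hpq)

end Finite

/-! ### Iterated splitting and fibers over a join-prime -/

section Split

variable {M : Type*} [CoheytingAlgebra M]

/-- Split off one index at a time, with the join of the remaining `β` as the other lower bound. The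
parts are differences of the form `a \ x`, so they inherit every relation `a \ x = a`; this keeps
the hypotheses of (S3) valid in the recursion. -/
theorem Splitting.exists_finset {ι : Type*} (hM : Splitting M) {s : Finset ι} (hs : s.Nonempty)
    (β : ι → M) : ∀ a : M, a ≠ ⊥ → s.sup β ≤ a → a \ s.sup β = a →
    ∃ α : ι → M, (∀ i ∈ s, α i ≠ ⊥ ∧ β i ≤ α i) ∧ s.sup α = a ∧
      (∀ i ∈ s, ∀ x, a \ x = a → α i \ x = α i) ∧
      ∀ i ∈ s, ∀ j ∈ s, i ≠ j → α i \ α j = α i ∧ α i ⊓ α j ≤ β i ⊓ β j := by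
  classical
  induction hs using Finset.Nonempty.cons_induction with
  | singleton i =>
    intro a ha hb hab
    refine ⟨fun _ => a, ?_, by simp, fun _ _ _ h => h, ?_⟩
    · simpa [ha] using hb
    · intro i hi j hj hij
      simp only [Finset.mem_singleton] at hi hj
      exact absurd (hi.trans hj.symm) hij
  | cons k s hk hs ih =>
    intro a ha hb hab
    rw [Finset.sup_cons] at hb hab
    obtain ⟨a₁, a₂, h₁, h₂, ⟨e₁, l₁⟩, ⟨e₂, l₂⟩, h₀⟩ := hM a (β k) (s.sup β) ⟨⟨hab, hb⟩, ha⟩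
    have hx : ∀ x, a \ x = a → a₁ \ x = a₁ ∧ a₂ \ x = a₂ := fun x h =>
      ⟨by rw [← e₁, sdiff_eq_self_of_sdiff h], by rw [← e₂, sdiff_eq_self_of_sdiff h]⟩
    have h12 : a₁ \ a₂ = a₁ := by rw [← e₁, sdiff_sdiff, sup_idem]
    have h21 : a₂ \ a₁ = a₂ := by rw [← e₂, sdiff_sdiff, sup_idem]
    have hsup : a₁ ⊔ a₂ = a := le_antisymm (sup_le (e₁ ▸ sdiff_le) (e₂ ▸ sdiff_le))
      (by rw [← e₂]; exact le_sup_sdiff)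
    obtain ⟨α, hα, hα', hαx, hαd⟩ := ih a₂ h₂ l₂
      (hx _ (sdiff_eq_self_of_le hab le_sup_right)).2
    have hle : ∀ j ∈ s, α j ≤ a₂ := fun j hj => hα' ▸ Finset.le_sup hj
    have hne : ∀ j ∈ s, j ≠ k := fun j hj h => hk (h ▸ hj)
    have hαk : ∀ j ∈ s, Function.update α k a₁ j = α j := fun j hj =>
      Function.update_of_ne (hne j hj) _ _
    have hinf : ∀ j ∈ s, a₁ ⊓ α j ≤ β k ⊓ β j := fun j hj => by
      have h1 : a₁ ⊓ α j ≤ β k ⊓ s.sup β := h₀ ▸ inf_le_inf_left _ (hle j hj)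
      refine le_inf (h1.trans inf_le_left) ?_
      have h2 : a₁ ⊓ α j ≤ s.sup β ⊓ α j := le_inf (h1.trans inf_le_right) inf_le_right
      refine h2.trans ?_
      -- For `l ≠ j`, the part of `β l` inside `α j` is in `α l ⊓ α j`, hence in `β j`.
      rw [Finset.sup_inf_distrib_right]
      refine Finset.sup_le fun l hl => ?_
      by_cases hlj : l = j
      · subst hlj; exact inf_le_left
      · exact (inf_le_inf_right _ (hα l hl).2).trans
          (((hαd l hl j hj hlj).2).trans inf_le_right)
    refine ⟨Function.update α k a₁, ?_, ?_, ?_, ?_⟩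
    · intro i hi
      rcases Finset.mem_cons.1 hi with rfl | hi
      · simpa using ⟨h₁, l₁⟩
      · rw [hαk i hi]; exact hα i hi
    · rw [Finset.sup_cons, Function.update_self, Finset.sup_congr rfl hαk, hα', hsup]
    · intro i hi x h
      rcases Finset.mem_cons.1 hi with rfl | hi
      · simpa using (hx x h).1
      · rw [hαk i hi]; exact hαx i hi x (hx x h).2
    · intro i hi j hj hij
      rcases Finset.mem_cons.1 hi with rfl | hi' <;>
        rcases Finset.mem_cons.1 hj with rfl | hj'
      · exact absurd rfl hij
      · rw [hαk j hj', Function.update_self]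
        exact ⟨sdiff_eq_self_of_le h12 (hle j hj'), hinf j hj'⟩
      · rw [hαk i hi', Function.update_self]
        exact ⟨hαx i hi' _ h21, by rw [inf_comm, inf_comm (β i)]; exact hinf i hi'⟩
      · rw [hαk i hi', hαk j hj']; exact hαd i hi' j hj' hij

variable {A : Type*} [CoheytingAlgebra A] [Finite A]

/-- Realisation in `M` of a prescribed finite fiber of minimal points over a join-prime. -/
theorem exists_minimal_fiber (hA : DimLEOne A) (hD : Density M) (hS : Splitting M)
    (f : CoheytingHom A M) (hf : Function.Injective f) {p : A} (hp : SupPrime p)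
    {ι : Type*} (s : Finset ι) (hs : ¬ Maximal SupPrime p → s.Nonempty) :
    ∃ α : ι → M, (∀ i ∈ s, α i ≠ ⊥ ∧ α i ≤ f p) ∧
      (∀ i ∈ s, ∀ j ∈ s, i ≠ j → α i ⊓ α j = ⊥) ∧
      (∀ p', ¬ p ≤ p' → ∀ i ∈ s, α i ⊓ f p' = ⊥) ∧
      (Maximal SupPrime p → ∀ i ∈ s, f p \ α i = f p) ∧
      (¬ Maximal SupPrime p → s.sup α = f p) := by
  classical
  have := Fintype.ofFinite A
  have hfp : f p ≠ ⊥ := fun h => hp.ne_bot (hf (h.trans (map_bot f).symm))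
  by_cases hm : Maximal SupPrime p
  · rcases s.eq_empty_or_nonempty with rfl | hne
    · exact ⟨fun _ => ⊥, by simp, by simp, by simp, by simp, fun h => absurd hm h⟩
    let e : A := (Finset.univ.filter fun x => SupPrime x ∧ x < p).sup id
    have hpe : p \ e = p := hp.sdiff_eq_self fun h => by
      obtain ⟨x, hx, hpx⟩ := hp.le_finset_sup.1 h
      simp only [Finset.mem_filter] at hx
      exact hx.2.2.not_ge hpx
    have hep : e ≤ p := Finset.sup_le fun x hx => by
      simp only [Finset.mem_filter] at hx
      exact hx.2.2.le
    have hinf : ∀ p', ¬ p ≤ p' → p ⊓ p' ≤ e := fun p' h => le_of_forall_supPrime fun r hr hrp =>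
      Finset.le_sup (f := id) (by
        simp only [Finset.mem_filter, Finset.mem_univ, true_and]
        exact ⟨hr, lt_of_le_of_ne (hrp.trans inf_le_left) fun h' =>
          h (h' ▸ hrp.trans inf_le_right)⟩)
    -- Splitting with lower bounds `f e` and `⊥` makes `a₂` disjoint from `a₁ ≥ f e`, hence from
    -- every `f p'` with `p` not below `p'`, because `p ⊓ p' ≤ e`.
    obtain ⟨a₁, a₂, -, h₂, ⟨e₁, l₁⟩, ⟨e₂, -⟩, hi⟩ := hS (f p) (f e) ⊥
      ⟨⟨by rw [sup_bot_eq, ← map_sdiff, hpe], by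
        rw [sup_bot_eq]; exact OrderHomClass.mono f hep⟩, hfp⟩
    rw [inf_bot_eq] at hi
    have hsup : a₁ ⊔ a₂ = f p := le_antisymm (sup_le (e₁ ▸ sdiff_le) (e₂ ▸ sdiff_le))
      (by rw [← e₂]; exact le_sup_sdiff)
    have hreg : f p = ⊤ \ (⊤ \ f p) := by
      rw [← map_top f, ← map_sdiff, ← map_sdiff, ← eq_top_sdiff_top_sdiff hm]
    -- Regularity passes from `f p` to its part `a₂`, so (D3) applies there and gives the room `b`
    -- in which all the fiber is placed.
    have hreg₂ : a₂ = ⊤ \ (⊤ \ a₂) := by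
      refine le_antisymm ?_ (sdiff_le_iff.2 (by rw [sup_comm]; exact le_sup_sdiff))
      rw [← e₂, sdiff_le_iff, e₂]
      conv_lhs => rw [hreg]
      rw [sdiff_le_iff]
      have h3 : (⊤ : M) \ a₂ ≤ (⊤ \ f p) ⊔ a₁ := by
        rw [sdiff_le_iff]
        calc (⊤ : M) ≤ f p ⊔ ⊤ \ f p := le_sup_sdiff
          _ ≤ a₂ ⊔ (⊤ \ f p ⊔ a₁) := by
            rw [← hsup]
            exact sup_le (sup_le (le_sup_of_le_right le_sup_right) le_sup_left)
              (le_sup_of_le_right le_sup_left)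
      calc (⊤ : M) ≤ (⊤ \ a₂) ⊔ ⊤ \ (⊤ \ a₂) := le_sup_sdiff
        _ ≤ ((⊤ \ f p) ⊔ a₁) ⊔ ⊤ \ (⊤ \ a₂) := sup_le_sup_right h3 _
        _ = _ := sup_assoc _ _ _
    obtain ⟨b, hb, hab, hba⟩ := hD a₂ ⟨hreg₂, h₂⟩
    have hb₁ : a₁ ⊓ b = ⊥ := le_bot_iff.1 (hi ▸ inf_le_inf_left _ hba)
    have hpb : f p \ b = f p := by
      rw [← hsup, sup_sdiff, hab, (disjoint_iff.2 hb₁).sdiff_eq_left]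
    obtain ⟨α, hα, hα', -, hαd⟩ := hS.exists_finset hne (fun _ => ⊥) b hb (by simp) (by simp)
    have hle : ∀ j ∈ s, α j ≤ b := fun j hj => hα' ▸ Finset.le_sup hj
    refine ⟨α, fun i hi => ⟨(hα i hi).1, (hle i hi).trans (hba.trans (e₂ ▸ sdiff_le))⟩,
      fun i hi j hj hij => le_bot_iff.1 (by simpa using (hαd i hi j hj hij).2),
      fun p' hp' i hi' => ?_, fun _ i hi => sdiff_eq_self_of_le hpb (hle i hi),
      fun h => absurd hm h⟩
    rw [← le_bot_iff, ← hb₁]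
    refine le_inf ?_ (inf_le_left.trans (hle i hi'))
    refine le_trans (le_trans ?_ (OrderHomClass.mono f (hinf p' hp'))) l₁
    rw [map_inf]
    exact inf_le_inf_right _ ((hle i hi').trans (hba.trans (e₂ ▸ sdiff_le)))
  -- A non-maximal `p` is minimal, so `f p` itself is partitioned by splitting with zero lower
  -- bounds.
  · obtain ⟨α, hα, hα', -, hαd⟩ := hS.exists_finset (hs hm) (fun _ => ⊥) (f p) hfp (by simp)
      (by simp)
    have hle : ∀ j ∈ s, α j ≤ f p := fun j hj => hα' ▸ Finset.le_sup hj
    refine ⟨α, fun i hi => ⟨(hα i hi).1, hle i hi⟩,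
      fun i hi j hj hij => le_bot_iff.1 (by simpa using (hαd i hi j hj hij).2),
      fun p' hp' i hi => ?_, fun h => absurd h hm, fun _ => hα'⟩
    have : p ⊓ p' = ⊥ := le_bot_iff.1 (le_of_forall_supPrime fun r hr hrp =>
      absurd ((hA.eq_of_le hp hm hr (hrp.trans inf_le_left)) ▸ hrp.trans inf_le_right) hp')
    rw [← le_bot_iff, ← map_bot f, ← this, map_inf]
    exact inf_le_inf_right _ (hle i hi)

end Split

end CoHeyting

namespace CoHeyting

/-! ### Duality for finite embeddings and realisation of finite extensions -/

section Embedding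

variable {A B M : Type*} [CoheytingAlgebra A] [CoheytingAlgebra B] [CoheytingAlgebra M]

/-- A homomorphism between finite co-Heyting algebras has a left adjoint. -/
theorem exists_leftAdjoint [Finite A] (i : CoheytingHom A B) :
    ∃ g : B → A, ∀ q a, g q ≤ a ↔ q ≤ i a := by
  classical
  have := Fintype.ofFinite A
  refine ⟨fun q => (Finset.univ.filter fun a => q ≤ i a).inf id, fun q a => ⟨fun h => ?_, fun h =>
    Finset.inf_le (f := id) (by simpa using h)⟩⟩
  refine le_trans ?_ (OrderHomClass.mono i h)
  rw [map_finset_inf]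
  exact Finset.le_inf fun a ha => by simpa using ha

theorem leftAdjoint_mono {i : CoheytingHom A B} {g : B → A} (hg : ∀ q a, g q ≤ a ↔ q ≤ i a)
    {q r : B} (h : q ≤ r) : g q ≤ g r :=
  (hg _ _).2 (h.trans ((hg _ _).1 le_rfl))

theorem leftAdjoint_supPrime {i : CoheytingHom A B} {g : B → A} (hg : ∀ q a, g q ≤ a ↔ q ≤ i a)
    {q : B} (hq : SupPrime q) : SupPrime (g q) := by
  refine ⟨fun h => hq.ne_bot ?_, fun b c h => ?_⟩
  · rw [isMin_iff_eq_bot] at h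
    have := (hg q ⊥).1 h.le
    rwa [map_bot, le_bot_iff] at this
  · rw [hg, map_sup] at h
    rw [hg, hg]
    exact hq.le_sup.1 h

/-- The left adjoint of a homomorphism is an upward p-morphism on join-primes. -/
theorem leftAdjoint_lift [Finite A] [Finite B] {i : CoheytingHom A B} {g : B → A}
    (hg : ∀ q a, g q ≤ a ↔ q ≤ i a)
    {q : B} (hq : SupPrime q) {p : A} (hp : SupPrime p) (h : g q ≤ p) :
    ∃ q', SupPrime q' ∧ q ≤ q' ∧ g q' = p := by
  classical
  have := Fintype.ofFinite A
  -- Since `p` is join-prime, `e` is the largest element not above `p`; a prime below `i p` and not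
  -- below `i e` is mapped by `g` exactly to `p`.
  let e : A := (Finset.univ.filter fun x => ¬ p ≤ x).sup id
  have hpe : ¬ p ≤ e := fun h => by
    obtain ⟨x, hx, hpx⟩ := hp.le_finset_sup.1 h
    exact (Finset.mem_filter.1 hx).2 hpx
  have h1 : q ≤ i p \ i e := by
    rw [← map_sdiff, hp.sdiff_eq_self hpe]
    exact (hg _ _).1 h
  obtain ⟨q', hq', hle, h2, h3⟩ := hq.exists_of_le_sdiff h1
  refine ⟨q', hq', hle, le_antisymm ((hg _ _).2 h2) ?_⟩
  by_contra hc
  exact h3 ((hg _ _).1 (Finset.le_sup (f := id) (by simpa using hc)))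

/-- Injectivity of `i` turns the decomposition of `i p` into primes `q` into a covering of `p` by
the `g q`; primality of `p` selects one of them. -/
theorem leftAdjoint_surjOn [Finite B] {i : CoheytingHom A B} (hi : Function.Injective i)
    {g : B → A} (hg : ∀ q a, g q ≤ a ↔ q ≤ i a) {p : A} (hp : SupPrime p) :
    ∃ q, SupPrime q ∧ g q = p := by
  classical
  obtain ⟨s, hs, hsp⟩ := exists_supIrred_decomposition (i p)
  have h1 : p ≤ s.sup g := by
    have h2 : i p ≤ i (s.sup g) := by
      rw [← hs]
      exact Finset.sup_le fun q hq => (hg _ _).1 (Finset.le_sup hq)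
    have h3 : i (p ⊓ s.sup g) = i p := by rw [map_inf, inf_eq_left.2 h2]
    exact inf_eq_left.1 (hi h3)
  obtain ⟨q, hq, hpq⟩ := hp.le_finset_sup.1 h1
  refine ⟨q, (hsp hq).supPrime, le_antisymm ((hg _ _).2 ?_) hpq⟩
  rw [← hs]
  exact Finset.le_sup (f := id) hq

/-- A family indexed by the join-primes of a finite algebra `B` which reproduces their order,
meets and differences induces an embedding of `B`. -/
theorem exists_hom_of_family [Finite B] (d : B → M)
    (h0 : ∀ q, SupPrime q → d q ≠ ⊥)
    (hmono : ∀ q r, SupPrime q → SupPrime r → q ≤ r → d q ≤ d r)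
    (hinf : ∀ q r x, SupPrime q → SupPrime r →
      (∀ t, SupPrime t → t ≤ q → t ≤ r → d t ≤ x) → d q ⊓ d r ≤ x)
    (hsdiff : ∀ q r, SupPrime q → SupPrime r → ¬ q ≤ r → d q \ d r = d q)
    (htop : ∀ x, (∀ q, SupPrime q → d q ≤ x) → x = ⊤) :
    ∃ h : CoheytingHom B M, Function.Injective h ∧
      ∀ b x, h b ≤ x ↔ ∀ q, SupPrime q → q ≤ b → d q ≤ x := by
  classical
  have := Fintype.ofFinite B
  let h : B → M := fun b => (Finset.univ.filter fun q => SupPrime q ∧ q ≤ b).sup d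
  have hh : ∀ b x, h b ≤ x ↔ ∀ q, SupPrime q → q ≤ b → d q ≤ x := fun b x => by
    simp [h, Finset.sup_le_iff]
  have hle : ∀ b q, SupPrime q → q ≤ b → d q ≤ h b := fun b q hq hb => (hh b _).1 le_rfl q hq hb
  have hhm : Monotone h := fun b c hbc => (hh _ _).2 fun q hq hb => hle _ _ hq (hb.trans hbc)
  have hd : ∀ q c, SupPrime q → ¬ q ≤ c → d q \ h c = d q := fun q c hq hqc =>
    sdiff_finset_sup_eq_self fun r hr => by
      simp only [Finset.mem_filter, Finset.mem_univ, true_and] at hr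
      exact hsdiff q r hq hr.1 fun h => hqc (h.trans hr.2)
  have hsup : ∀ b c, h (b ⊔ c) = h b ⊔ h c := fun b c =>
    le_antisymm ((hh _ _).2 fun q hq hqb => by
      rcases hq.le_sup.1 hqb with h | h
      · exact le_sup_of_le_left (hle _ _ hq h)
      · exact le_sup_of_le_right (hle _ _ hq h))
      (sup_le (hhm le_sup_left) (hhm le_sup_right))
  refine ⟨{ toFun := h, map_sup' := hsup, map_inf' := fun b c => le_antisymm ?_ ?_, map_top' := ?_,
            map_sdiff' := fun b c => le_antisymm ?_ ?_ }, ?_, hh⟩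
  · exact le_inf (hhm inf_le_left) (hhm inf_le_right)
  · change (Finset.sup _ _ ⊓ Finset.sup _ _ : M) ≤ _
    simp only [Finset.sup_inf_distrib_left, Finset.sup_inf_distrib_right, Finset.sup_le_iff,
      Finset.mem_filter, Finset.mem_univ, true_and]
    intro q hq r hr
    exact hinf _ _ _ (by tauto) (by tauto) fun t ht h1 h2 => hle _ _ ht
      (le_inf (h1.trans hr.2) (h2.trans hq.2))
  · exact htop _ fun q hq => hle _ _ hq le_top
  · refine (hh _ _).2 fun q hq hqb => ?_
    obtain ⟨q', hq', hqq, h1, h2⟩ := hq.exists_of_le_sdiff hqb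
    -- Move up to the prime `q'`, whose value loses nothing on removing `h c`.
    refine (hmono _ _ hq hq' hqq).trans ?_
    rw [← hd q' c hq' h2]
    exact sdiff_le_sdiff_right (hle _ _ hq' h1)
  · rw [sdiff_le_iff, ← hsup]
    exact hhm le_sup_sdiff
  · have key : ∀ b c, h b = h c → b ≤ c := fun b c hbc => le_of_forall_supPrime fun q hq hqb => by
      by_contra hqc
      refine h0 q hq ?_
      rw [← hd q c hq hqc, ← hbc, sdiff_eq_bot_iff]
      exact hle _ _ hq hqb
    exact fun b c hbc => le_antisymm (key b c hbc) (key c b hbc.symm)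

/-- Over a model of (D3) and (S3), every finite extension of a finite subalgebra is realised. -/
theorem exists_extension [Finite A] [Finite B] (hB : DimLEOne B) (hD : Density M)
    (hS : Splitting M)
    (i : CoheytingHom A B) (hi : Function.Injective i)
    (f : CoheytingHom A M) (hf : Function.Injective f) :
    ∃ h : CoheytingHom B M, Function.Injective h ∧ ∀ a, h (i a) = f a := by
  classical
  have := Fintype.ofFinite B
  have hA : DimLEOne A := hB.of_injective i hi
  obtain ⟨g, hg⟩ := exists_leftAdjoint i
  have gmono : ∀ {q r : B}, q ≤ r → g q ≤ g r := fun h => leftAdjoint_mono hg h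
  have gprime : ∀ {q}, SupPrime q → SupPrime (g q) := fun h => leftAdjoint_supPrime hg h
  have fmono : ∀ {a b}, a ≤ b → f a ≤ f b := fun h => OrderHomClass.mono f h
  have fne : ∀ {p : A}, SupPrime p → f p ≠ ⊥ := fun {p} hp h =>
    hp.ne_bot (hf (h.trans (map_bot f).symm))
  have fsdiff : ∀ {p a : A}, SupPrime p → ¬ p ≤ a → f p \ f a = f p := fun {p a} hp h => by
    rw [← map_sdiff, hp.sdiff_eq_self h]
  -- the maximal join-primes of `B` are mapped onto those of `A`
  have gmax : ∀ {q}, Maximal SupPrime q → Maximal SupPrime (g q) := fun {q} hq =>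
    ⟨gprime hq.prop, fun p hp hqp => by
      obtain ⟨q', hq', hle, rfl⟩ := leftAdjoint_lift hg hq.prop hp hqp
      exact gmono (hq.2 hq' hle)⟩
  have liftmax : ∀ {q m}, SupPrime q → Maximal SupPrime m → g q ≤ m →
      ∃ q', Maximal SupPrime q' ∧ q ≤ q' ∧ g q' = m := fun {q m} hq hm h => by
    obtain ⟨q', hq', hle, rfl⟩ := leftAdjoint_lift hg hq hm.prop h
    obtain ⟨q'', hq'', hle'⟩ := hB.exists_maximal hq'
    exact ⟨q'', hq'', hle.trans hle', le_antisymm (hm.2 (gprime hq''.prop) (gmono hle'))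
      (gmono hle')⟩
  let N : Finset B := Finset.univ.filter fun r => SupPrime r ∧ ¬ Maximal SupPrime r
  have hN : ∀ {r}, r ∈ N ↔ SupPrime r ∧ ¬ Maximal SupPrime r := by simp [N]
  -- the values at the non-maximal join-primes
  have h1 : ∀ p : A, ∃ α : B → M, SupPrime p →
      (∀ r ∈ N, g r = p → α r ≠ ⊥ ∧ α r ≤ f p) ∧
      (∀ r ∈ N, g r = p → ∀ r' ∈ N, g r' = p → r ≠ r' → α r ⊓ α r' = ⊥) ∧
      (∀ p', ¬ p ≤ p' → ∀ r ∈ N, g r = p → α r ⊓ f p' = ⊥) ∧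
      (Maximal SupPrime p → ∀ r ∈ N, g r = p → f p \ α r = f p) ∧
      (¬ Maximal SupPrime p → ∀ x, (∀ r ∈ N, g r = p → α r ≤ x) → f p ≤ x) := fun p => by
    by_cases hp : SupPrime p
    · obtain ⟨α, c1, c2, c3, c4, c5⟩ := exists_minimal_fiber hA hD hS f hf hp
        (N.filter fun r => g r = p) (fun hm => by
          obtain ⟨q, hq, rfl⟩ := leftAdjoint_surjOn hi hg hp
          exact ⟨q, Finset.mem_filter.2 ⟨hN.2 ⟨hq, fun h => hm (gmax h)⟩, rfl⟩⟩)
      simp only [Finset.mem_filter, and_imp] at c1 c2 c3 c4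
      exact ⟨α, fun _ => ⟨c1, c2, c3, c4, fun hm x hx => by
        rw [← c5 hm]
        exact Finset.sup_le fun r hr => hx r (Finset.mem_filter.1 hr).1 (Finset.mem_filter.1 hr).2⟩⟩
    · exact ⟨fun _ => ⊥, fun h => absurd h hp⟩
  choose α hα using h1
  -- Each fiber was treated separately; `δ` reads off the value of `r` in its own fiber.
  let δ : B → M := fun r => α (g r) r
  have δne : ∀ r ∈ N, δ r ≠ ⊥ := fun r hr => ((hα _ (gprime (hN.1 hr).1)).1 r hr rfl).1
  have δle : ∀ r ∈ N, δ r ≤ f (g r) := fun r hr => ((hα _ (gprime (hN.1 hr).1)).1 r hr rfl).2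
  have δdisj' : ∀ r ∈ N, ∀ p, ¬ g r ≤ p → δ r ⊓ f p = ⊥ := fun r hr p hp =>
    (hα _ (gprime (hN.1 hr).1)).2.2.1 p hp r hr rfl
  have δdisj : ∀ r ∈ N, ∀ r' ∈ N, r ≠ r' → δ r ⊓ δ r' = ⊥ := by
    intro r hr r' hr' hne
    by_cases hle : g r ≤ g r'
    · by_cases hle' : g r' ≤ g r
      · have e := le_antisymm hle hle'
        have := (hα _ (gprime (hN.1 hr).1)).2.1 r hr rfl r' hr' e.symm hne
        simpa only [δ, ← e] using this
      · rw [inf_comm, ← le_bot_iff, ← δdisj' r' hr' _ hle']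
        exact inf_le_inf_left _ (δle r hr)
    · rw [← le_bot_iff, ← δdisj' r hr _ hle]
      exact inf_le_inf_left _ (δle r' hr')
  have δsd : ∀ m, Maximal SupPrime m → ∀ r ∈ N, f m \ δ r = f m := by
    intro m hm r hr
    by_cases hmr : m ≤ g r
    · have e : g r = m := le_antisymm (hm.2 (gprime (hN.1 hr).1) hmr) hmr
      exact (hα m hm.prop).2.2.2.1 hm r hr e ▸ by simp only [δ, e, sdiff_idem]
    · exact sdiff_eq_self_of_le (fsdiff hm.prop hmr) (δle r hr)
  have δsup : ∀ p, SupPrime p → ¬ Maximal SupPrime p → ∀ x, (∀ r ∈ N, g r = p → δ r ≤ x) →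
      f p ≤ x := fun p hp hm x hx => (hα p hp).2.2.2.2 hm x fun r hr e => by
    have := hx r hr e
    simpa only [δ, e] using this
  -- the values at the maximal join-primes
  let β : B → M := fun q => (N.filter fun r => r ≤ q).sup δ
  have hβ : ∀ q r, r ∈ N → r ≤ q → δ r ≤ β q := fun q r hr h =>
    Finset.le_sup (f := δ) (Finset.mem_filter.2 ⟨hr, h⟩)
  have hβle : ∀ q x, (∀ r ∈ N, r ≤ q → δ r ≤ x) → β q ≤ x := fun q x h =>
    Finset.sup_le fun r hr => h r (Finset.mem_filter.1 hr).1 (Finset.mem_filter.1 hr).2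
  -- (S3) applies with lower bounds `β q` because every `δ r` is removable from `f m`, by `δsd`.
  have h2 : ∀ m : A, ∃ γ : B → M, Maximal SupPrime m →
      (∀ q, Maximal SupPrime q → g q = m → γ q ≠ ⊥ ∧ β q ≤ γ q ∧ γ q ≤ f m) ∧
      (∀ x, (∀ q, Maximal SupPrime q → g q = m → γ q ≤ x) → f m ≤ x) ∧
      (∀ q, Maximal SupPrime q → g q = m → ∀ x, f m \ x = f m → γ q \ x = γ q) ∧
      (∀ q, Maximal SupPrime q → g q = m → ∀ q', Maximal SupPrime q' → g q' = m → q ≠ q' →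
        γ q \ γ q' = γ q ∧ γ q ⊓ γ q' ≤ β q ⊓ β q') := fun m => by
    by_cases hm : Maximal SupPrime m
    · obtain ⟨q₀, hq₀, e₀⟩ := leftAdjoint_surjOn hi hg hm.prop
      obtain ⟨q₁, hq₁, -, e₁⟩ := liftmax hq₀ hm e₀.le
      obtain ⟨γ, c1, c2, c3, c4⟩ := hS.exists_finset
        (s := Finset.univ.filter fun q => Maximal SupPrime q ∧ g q = m)
        ⟨q₁, by simp [hq₁, e₁]⟩ β (f m) (fne hm.prop)
        (Finset.sup_le fun q hq => hβle _ _ fun r hr hrq => (δle r hr).trans (fmono (by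
          simp only [Finset.mem_filter] at hq
          exact hq.2.2 ▸ gmono hrq)))
        (sdiff_finset_sup_eq_self fun q hq => sdiff_finset_sup_eq_self fun r hr =>
          δsd m hm r (Finset.mem_filter.1 hr).1)
      simp only [Finset.mem_filter, Finset.mem_univ, true_and, and_imp] at c1 c3 c4
      refine ⟨γ, fun _ => ⟨fun q hq e => ⟨(c1 q hq e).1, (c1 q hq e).2, ?_⟩, fun x hx => ?_,
        c3, c4⟩⟩
      · rw [← c2]
        exact Finset.le_sup (f := γ) (by simp [hq, e])
      · rw [← c2]
        refine Finset.sup_le fun q hq => ?_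
        simp only [Finset.mem_filter, Finset.mem_univ, true_and] at hq
        exact hx q hq.1 hq.2
    · exact ⟨fun _ => ⊥, fun h => absurd h hm⟩
  choose γ hγ using h2
  let ε : B → M := fun q => γ (g q) q
  have εne : ∀ q, Maximal SupPrime q → ε q ≠ ⊥ := fun q hq => ((hγ _ (gmax hq)).1 q hq rfl).1
  have εβ : ∀ q, Maximal SupPrime q → β q ≤ ε q := fun q hq => ((hγ _ (gmax hq)).1 q hq rfl).2.1
  have εle : ∀ q, Maximal SupPrime q → ε q ≤ f (g q) := fun q hq =>
    ((hγ _ (gmax hq)).1 q hq rfl).2.2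
  have εsup : ∀ m, Maximal SupPrime m → ∀ x, (∀ q, Maximal SupPrime q → g q = m → ε q ≤ x) →
      f m ≤ x := fun m hm x hx => (hγ m hm).2.1 x fun q hq e => by
    have := hx q hq e
    simpa only [ε, e] using this
  have εsd : ∀ q, Maximal SupPrime q → ∀ x, f (g q) \ x = f (g q) → ε q \ x = ε q :=
    fun q hq x hx => (hγ _ (gmax hq)).2.2.1 q hq rfl x hx
  have εε : ∀ q q', Maximal SupPrime q → Maximal SupPrime q' → g q = g q' → q ≠ q' →
      ε q \ ε q' = ε q ∧ ε q ⊓ ε q' ≤ β q ⊓ β q' := fun q q' hq hq' e hne => by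
    have := (hγ _ (gmax hq)).2.2.2 q hq rfl q' hq' e.symm hne
    simpa only [ε, ← e] using this
  -- If `g r ≤ g q`, lift `r` to some `q' ≠ q` in the fiber of `q`. Then `δ r ≤ ε q'`, so it meets
  -- `ε q` only inside `β q`, a join of elements disjoint from `δ r`.
  have δε : ∀ r ∈ N, ∀ q, Maximal SupPrime q → ¬ r ≤ q → δ r ⊓ ε q = ⊥ := by
    intro r hr q hq hrq
    by_cases hle : g r ≤ g q
    · obtain ⟨q', hq', hrq', e⟩ := liftmax (hN.1 hr).1 (gmax hq) hle
      have hne : q' ≠ q := fun h => hrq (h ▸ hrq')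
      have h3 : δ r ⊓ ε q ≤ δ r ⊓ β q := le_inf inf_le_left
        ((inf_le_inf_right _ ((hβ q' r hr hrq').trans (εβ q' hq'))).trans
          ((εε q' q hq' hq e hne).2.trans inf_le_right))
      rw [← le_bot_iff]
      refine h3.trans ?_
      simp only [β, Finset.sup_inf_distrib_left]
      refine Finset.sup_le fun r' hr' => ?_
      rw [Finset.mem_filter] at hr'
      exact (δdisj r hr r' hr'.1 fun h => hrq (h ▸ hr'.2)).le
    · rw [← le_bot_iff, ← δdisj' r hr _ hle]
      exact inf_le_inf_left _ (εle q hq)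
  -- the whole family
  let d : B → M := fun q => if Maximal SupPrime q then ε q else δ q
  have dmax : ∀ {q}, Maximal SupPrime q → d q = ε q := fun h => if_pos h
  have dN : ∀ {q}, q ∈ N → d q = δ q := fun h => if_neg (hN.1 h).2
  have cases' : ∀ {q}, SupPrime q → Maximal SupPrime q ∨ q ∈ N := fun {q} hq => by
    by_cases h : Maximal SupPrime q
    · exact Or.inl h
    · exact Or.inr (hN.2 ⟨hq, h⟩)
  have dle : ∀ q, SupPrime q → d q ≤ f (g q) := fun q hq => by
    rcases cases' hq with h | h
    · rw [dmax h]; exact εle q h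
    · rw [dN h]; exact δle q h
  have dsup : ∀ p, SupPrime p → ∀ x, (∀ q, SupPrime q → g q = p → d q ≤ x) → f p ≤ x := by
    intro p hp x hx
    by_cases hm : Maximal SupPrime p
    · exact εsup p hm x fun q hq e => dmax hq ▸ hx q hq.prop e
    · exact δsup p hp hm x fun r hr e => dN hr ▸ hx r (hN.1 hr).1 e
  have fsup : ∀ a x, (∀ p, SupPrime p → p ≤ a → f p ≤ x) → f a ≤ x := fun a x hx => by
    obtain ⟨s, rfl, hs⟩ := exists_supIrred_decomposition a
    rw [map_finset_sup]
    exact Finset.sup_le fun p hp => hx p (hs hp).supPrime (Finset.le_sup (f := id) hp)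
  have minN : ∀ {r q}, r ∈ N → SupPrime q → q ≤ r → q = r := fun hr hq h =>
    hB.eq_of_le (hN.1 hr).1 (hN.1 hr).2 hq h
  refine (exists_hom_of_family d ?_ ?_ ?_ ?_ ?_).imp fun h ⟨hinj, hh⟩ => ⟨hinj, fun a =>
    le_antisymm ((hh _ _).2 fun q hq hqa => (dle q hq).trans (fmono ((hg _ _).2 hqa)))
      (fsup _ _ fun p hp hpa => dsup p hp _ fun q hq e =>
        (hh _ _).1 le_rfl q hq ((hg _ _).1 (e.le.trans hpa)))⟩
  · intro q hq
    rcases cases' hq with h | h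
    · rw [dmax h]; exact εne q h
    · rw [dN h]; exact δne q h
  · intro q r hq hr hqr
    rcases cases' hr with h | h
    · rcases cases' hq with h' | h'
      · rw [le_antisymm hqr (h'.2 hr hqr)]
      · rw [dN h', dmax h]
        exact (hβ r q h' hqr).trans (εβ r h)
    · rw [minN h hq hqr]
  · intro q r x hq hr hx
    rcases eq_or_ne q r with rfl | hne
    · exact inf_le_left.trans (hx q hq le_rfl le_rfl)
    rcases cases' hq with h | h <;> rcases cases' hr with h' | h'
    · have hββ : ε q ⊓ ε r ≤ β q := by
        by_cases e : g q = g r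
        · exact (εε q r h h' e hne).2.trans inf_le_left
        · have h3 : ε q ⊓ ε r ≤ f (g q ⊓ g r) := by
            rw [map_inf]; exact inf_le_inf (εle q h) (εle r h')
          -- Primes below two distinct maximal primes are non-maximal, so the overlap is covered by
          -- the `δ t`; those with `t` not below `q` vanish on `ε q`.
          have h4 : f (g q ⊓ g r) ≤ (N : Finset B).sup δ := fsup _ _ fun p hp hpa =>
            δsup p hp (fun hm => e ((le_antisymm (hpa.trans inf_le_left)
              (hm.2 (gprime hq) (hpa.trans inf_le_left))).symm.trans
              (le_antisymm (hpa.trans inf_le_right)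
              (hm.2 (gprime hr) (hpa.trans inf_le_right)))))  _ fun t ht _ => Finset.le_sup ht
          have h5 : ε q ⊓ ε r ≤ N.sup δ ⊓ ε q := le_inf (h3.trans h4) inf_le_left
          refine h5.trans ?_
          rw [Finset.sup_inf_distrib_right]
          refine Finset.sup_le fun t ht => ?_
          by_cases htq : t ≤ q
          · exact inf_le_left.trans (hβ q t ht htq)
          · rw [δε t ht q h htq]; exact bot_le
      have h3 : ε q ⊓ ε r ≤ β q ⊓ ε r := le_inf hββ inf_le_right
      rw [dmax h, dmax h']
      refine h3.trans ?_
      simp only [β, Finset.sup_inf_distrib_right]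
      refine Finset.sup_le fun t ht => ?_
      rw [Finset.mem_filter] at ht
      by_cases htr : t ≤ r
      · exact inf_le_left.trans (dN ht.1 ▸ hx t (hN.1 ht.1).1 ht.2 htr)
      · rw [δε t ht.1 r h' htr]; exact bot_le
    · by_cases hrq : r ≤ q
      · exact inf_le_right.trans (hx r hr hrq le_rfl)
      · rw [inf_comm, dmax h, dN h', δε r h' q h hrq]; exact bot_le
    · by_cases hqr : q ≤ r
      · exact inf_le_left.trans (hx q hq le_rfl hqr)
      · rw [dmax h', dN h, δε q h r h' hqr]; exact bot_le
    · rw [dN h, dN h', δdisj q h r h' hne]; exact bot_le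
  · intro q r hq hr hqr
    rcases cases' hq with h | h <;> rcases cases' hr with h' | h'
    · rw [dmax h, dmax h']
      by_cases e : g q = g r
      · exact (εε q r h h' e fun h => hqr h.le).1
      · refine εsd q h _ (sdiff_eq_self_of_le (fsdiff (gprime hq) fun hle => e ?_) (εle r h'))
        exact le_antisymm hle ((gmax h).2 (gprime hr) hle)
    · rw [dmax h, dN h']
      exact εsd q h _ (δsd _ (gmax h) r h')
    · rw [dmax h', dN h]
      exact (disjoint_iff.2 (δε q h r h' hqr)).sdiff_eq_left
    · rw [dN h, dN h']
      exact (disjoint_iff.2 (δdisj q h r h' fun h => hqr h.le)).sdiff_eq_left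
  · intro x hx
    rw [← top_le_iff, ← map_top f]
    exact fsup _ _ fun p hp _ => dsup p hp x fun q hq _ => hx q hq

end Embedding
end CoHeyting

namespace CoHeyting

/-! ### Algebras of lower sets -/

section LowerSet

theorem mem_lowerSet_sdiff {X : Type*} [PartialOrder X] {D E : LowerSet X} {x : X} :
    x ∈ D \ E ↔ ∃ y, x ≤ y ∧ y ∈ D ∧ y ∉ E := by
  let F : LowerSet X := ⟨{x | ∃ y, x ≤ y ∧ y ∈ D ∧ y ∉ E}, fun a b hba ⟨y, h, h'⟩ =>
    ⟨y, hba.trans h, h'⟩⟩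
  have : D \ E = F := by
    refine le_antisymm (sdiff_le_iff.2 fun y hy => ?_) fun z ⟨y, hzy, hy, hyE⟩ => ?_
    · by_cases h : y ∈ E
      · exact Or.inl h
      · exact Or.inr ⟨y, le_rfl, hy, h⟩
    · have h : D ≤ E ⊔ D \ E := le_sup_sdiff
      exact (D \ E).lower hzy ((LowerSet.mem_sup_iff.1 (h hy)).resolve_left hyE)
  rw [this]
  rfl

/-- Each of the two differences moves strictly upwards, so a point in the meet would start a
three-element chain. -/
theorem dimLEOne_lowerSet {X : Type*} [PartialOrder X] (hX : ∀ x y z : X, x < y → ¬ y < z) :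
    DimLEOne (LowerSet X) := by
  refine fun D E => le_bot_iff.1 fun x hx => ?_
  obtain ⟨h1, hxE⟩ := LowerSet.mem_inf_iff.1 hx
  obtain ⟨y, hxy, hy, hyE⟩ := mem_lowerSet_sdiff.1 h1
  obtain ⟨h2, hyD⟩ := LowerSet.mem_inf_iff.1 hy
  obtain ⟨z, hyz, -, hz⟩ := mem_lowerSet_sdiff.1 h2
  exact (hX x y z (lt_of_le_of_ne hxy fun h => hyE (h ▸ hxE))
    (lt_of_le_of_ne hyz fun h => hz (h ▸ hyD))).elim

/-- The inverse image homomorphism of an upward p-morphism. -/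
noncomputable def lowerSetComap {X Y : Type*} [PartialOrder X] [PartialOrder Y] (π : Y → X)
    (hπ : Monotone π) (lift : ∀ y x, π y ≤ x → ∃ y', y ≤ y' ∧ π y' = x) :
    CoheytingHom (LowerSet X) (LowerSet Y) where
  toFun D := ⟨π ⁻¹' D, fun _ _ h => D.lower (hπ h)⟩
  map_sup' _ _ := rfl
  map_inf' _ _ := rfl
  map_top' := rfl
  map_sdiff' D E := by
    ext y
    change π y ∈ D \ E ↔ y ∈ (_ \ _ : LowerSet Y)
    rw [mem_lowerSet_sdiff, mem_lowerSet_sdiff]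
    constructor
    · rintro ⟨x, hx, h⟩
      obtain ⟨y', hy, rfl⟩ := lift y x hx
      exact ⟨y', hy, h⟩
    · rintro ⟨y', hy, h⟩
      exact ⟨π y', hπ hy, h⟩

theorem lowerSetComap_injective {X Y : Type*} [PartialOrder X] [PartialOrder Y] (π : Y → X)
    (hπ : Monotone π) (lift : ∀ y x, π y ≤ x → ∃ y', y ≤ y' ∧ π y' = x)
    (hs : Function.Surjective π) : Function.Injective (lowerSetComap π hπ lift) := by
  intro D E h
  ext x
  obtain ⟨y, rfl⟩ := hs x
  exact (Set.ext_iff.1 (congrArg (fun F : LowerSet Y => (F : Set Y)) h) y)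

end LowerSet

/-! ### Prime ideal representation and local finiteness -/

section Spectrum

/-- Every co-Heyting algebra of dimension at most one embeds into the algebra of lower sets of a
poset whose chains have at most two elements. -/
theorem exists_spectrum (M : Type u) [CoheytingAlgebra M] (hM : DimLEOne M) :
    ∃ (X : Type u) (_ : PartialOrder X) (f : CoheytingHom M (LowerSet X)),
      Function.Injective f ∧ ∀ x y z : X, x < y → ¬ y < z := by
  let X := {I : Order.Ideal M // I.IsPrime}
  have hmem : ∀ (I : X) (a b : M), a ⊓ b ∈ I.1 → a ∈ I.1 ∨ b ∈ I.1 := fun I a b h =>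
    I.2.mem_or_mem h
  have htop : ∀ I : X, (⊤ : M) ∉ I.1 := fun I h => I.2.toIsProper.top_notMem h
  have hsep : ∀ (I : Order.Ideal M) (a : M), a ∉ I → ∃ J : X, I ≤ J.1 ∧ a ∉ J.1 := by
    intro I a ha
    obtain ⟨J, hJ, hIJ, hd⟩ := DistribLattice.prime_ideal_of_disjoint_filter_ideal
      (F := Order.PFilter.principal a) (I := I) (Set.disjoint_left.2 fun x hx hxI =>
        ha (I.lower (Order.PFilter.mem_principal.1 hx) hxI))
    exact ⟨⟨J, hJ⟩, hIJ, Set.disjoint_left.1 hd (Order.PFilter.mem_principal.2 le_rfl)⟩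
  -- Ideals omitting `a` are closed under passing to smaller ideals, hence form a lower set.
  let φ : M → LowerSet X := fun a => ⟨{I | a ∉ I.1}, fun I J h ha h' => ha (h h')⟩
  refine ⟨X, inferInstance, ⟨⟨⟨φ, fun a b => ?_⟩, fun a b => ?_⟩, ?_, fun a b => ?_⟩, fun a b hab => ?_, fun I J K hIJ hJK => ?_⟩
  · ext I
    change ¬ _ ↔ ¬ _ ∨ ¬ _
    rw [Order.Ideal.sup_mem_iff]
    tauto
  · ext I
    change ¬ _ ↔ ¬ _ ∧ ¬ _
    have := hmem I a b
    have h1 : a ∈ I.1 → a ⊓ b ∈ I.1 := fun h => I.1.lower inf_le_left h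
    have h2 : b ∈ I.1 → a ⊓ b ∈ I.1 := fun h => I.1.lower inf_le_right h
    tauto
  · ext I
    exact ⟨fun _ => trivial, fun _ => htop I⟩
  · ext J
    change a \ b ∉ J.1 ↔ J ∈ (φ a \ φ b : LowerSet X)
    rw [mem_lowerSet_sdiff]
    constructor
    · intro h
      -- The ideal generated by `J` and `b` contains `a` only if `a \ b ∈ J`.
      obtain ⟨I, hI, haI⟩ := hsep (J.1 ⊔ Order.Ideal.principal b) a (fun ha => by
        obtain ⟨j, hj, c, hc, hle⟩ := Order.Ideal.mem_sup.1 ha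
        refine h (J.1.lower (sdiff_le_iff.2 (hle.trans ?_)) hj)
        rw [sup_comm]
        exact sup_le_sup_right (Order.Ideal.mem_principal.1 hc) j)
      exact ⟨I, le_sup_left.trans hI, haI, fun hb =>
        hb (hI ((le_sup_right : _ ≤ J.1 ⊔ Order.Ideal.principal b)
          (Order.Ideal.mem_principal.2 le_rfl)))⟩
    · rintro ⟨I, hJI, haI, hbI⟩ h
      refine haI (I.1.lower (le_sup_sdiff : a ≤ b ⊔ a \ b)
        (Order.Ideal.sup_mem (not_not.1 hbI) (hJI h)))
  · have key : ∀ a b, φ a = φ b → a ≤ b := fun a b hab => by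
      by_contra hle
      obtain ⟨J, hJ, haJ⟩ := hsep (Order.Ideal.principal b) a
        (fun h => hle (Order.Ideal.mem_principal.1 h))
      have : J ∈ φ b := hab ▸ (show J ∈ φ a from haJ)
      exact this (hJ (Order.Ideal.mem_principal.2 le_rfl))
    exact le_antisymm (key a b hab) (key b a hab.symm)
  -- In a chain `I < J < K`, the defining equation at `x ∈ K \ J` and `y ∈ J \ I` has its left side
  -- outside `I`, yet it is `⊥`.
  · obtain ⟨x, hxK, hxJ⟩ := Set.exists_of_ssubset (show (J.1 : Set M) ⊂ K.1 from hJK)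
    obtain ⟨y, hyJ, hyI⟩ := Set.exists_of_ssubset (show (I.1 : Set M) ⊂ J.1 from hIJ)
    have h1 : ⊤ \ x ∉ K.1 := fun h => htop K
      (K.1.lower (le_sup_sdiff : (⊤ : M) ≤ x ⊔ ⊤ \ x) (Order.Ideal.sup_mem hxK h))
    have h2 : (⊤ \ x) ⊓ x ∉ J.1 := fun h => (hmem J _ _ h).elim (fun h => h1 (hJK.le h)) hxJ
    have h3 : ((⊤ \ x) ⊓ x) \ y ∉ J.1 := fun h => h2 (J.1.lower le_sup_sdiff
      (Order.Ideal.sup_mem hyJ h))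
    have h4 : (((⊤ \ x) ⊓ x) \ y) ⊓ y ∈ I.1 := by rw [hM x y]; exact I.1.bot_mem
    exact (hmem I _ _ h4).elim (fun h => h3 (hIJ.le h)) hyI

/-- Finitely generated co-Heyting algebras of dimension at most one are finite. -/
theorem exists_finite_closed {M : Type u} [CoheytingAlgebra M] (hM : DimLEOne M)
    {ι : Type*} [Finite ι] (v : ι → M) :
    ∃ S : Set M, S.Finite ∧ (∀ i, v i ∈ S) ∧ ⊥ ∈ S ∧ ⊤ ∈ S ∧
      ∀ a ∈ S, ∀ b ∈ S, a ⊔ b ∈ S ∧ a ⊓ b ∈ S ∧ a \ b ∈ S := by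
  obtain ⟨X, _, f, hf, hX⟩ := exists_spectrum M hM
  let σ : X → Set ι := fun x => {i | x ∈ f (v i)}
  -- In depth two, a point is described by the generators containing it and the analogous sets for
  -- the points strictly above it. `S` consists of the elements that are unions of classes of `τ`,
  -- of which there are finitely many.
  let τ : X → Set ι × Set (Set ι) := fun x => (σ x, {s | ∃ m, x < m ∧ σ m = s})
  let S : Set M := {a | ∀ x x', τ x = τ x' → x ∈ f a → x' ∈ f a}
  refine ⟨S, ?_, ?_, ?_, ?_, ?_⟩
  · refine Set.Finite.of_injOn (f := fun a => τ '' (f a : Set X)) (t := Set.univ)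
      (fun _ _ => trivial) ?_ Set.finite_univ
    have key : ∀ a b : M, b ∈ S → τ '' (f a : Set X) = τ '' (f b : Set X) → f a ≤ f b := by
      intro a b hb hab x hx
      have : τ x ∈ τ '' (f b : Set X) := hab ▸ ⟨x, hx, rfl⟩
      obtain ⟨x', hx', e⟩ := this
      exact hb x' x e hx'
    exact fun a ha b hb hab => hf (le_antisymm (key a b hb hab) (key b a ha hab.symm))
  · intro i x x' e hx
    have : i ∈ σ x' := (Set.ext_iff.1 (congrArg Prod.fst e) i).1 hx
    exact this
  · intro x x' _ hx
    rw [map_bot] at hx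
    exact hx.elim
  · intro x x' _ _
    rw [map_top]
    trivial
  · intro a ha b hb
    refine ⟨fun x x' e hx => ?_, fun x x' e hx => ?_, fun x x' e hx => ?_⟩
    · rw [map_sup, LowerSet.mem_sup_iff] at hx ⊢
      exact hx.imp (ha x x' e) (hb x x' e)
    · rw [map_inf, LowerSet.mem_inf_iff] at hx ⊢
      exact hx.imp (ha x x' e) (hb x x' e)
    · rw [map_sdiff, mem_lowerSet_sdiff] at hx ⊢
      obtain ⟨y, hxy, hya, hyb⟩ := hx
      rcases hxy.eq_or_lt with rfl | hlt
      · exact ⟨x', le_rfl, ha _ _ e hya, fun h => hyb (hb _ _ e.symm h)⟩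
      · have h1 : σ y ∈ {s | ∃ m, x' < m ∧ σ m = s} :=
          (Set.ext_iff.1 (congrArg Prod.snd e) (σ y)).1 ⟨y, hlt, rfl⟩
        obtain ⟨m, hm, hσ⟩ := h1
        -- Both points already have something below them, so nothing lies above either.
        have e' : τ y = τ m := by
          refine Prod.ext hσ.symm ?_
          ext s
          exact ⟨fun ⟨z, hz, _⟩ => (hX _ _ _ hlt hz).elim, fun ⟨z, hz, _⟩ => (hX _ _ _ hm hz).elim⟩
        exact ⟨m, hm.le, ha _ _ e' hya, fun h => hyb (hb _ _ e'.symm h)⟩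

end Spectrum

/-! ### Extensions containing witnesses for (D3) and (S3) -/

section Extension

/-- The partial order on `Y` generated by a relation `R` none of whose pairs can be composed. -/
@[reducible] def twoLevelOrder {Y : Type*} (R : Y → Y → Prop) (hR : ∀ a b c, R a b → ¬ R b c) :
    PartialOrder Y where
  le a b := a = b ∨ R a b
  le_refl _ := Or.inl rfl
  le_trans a b c := by
    rintro (rfl | h) (rfl | h')
    · exact Or.inl rfl
    · exact Or.inr h'
    · exact Or.inr h
    · exact (hR _ _ _ h h').elim
  le_antisymm a b := by
    rintro (rfl | h) (h' | h')
    · rfl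
    · rfl
    · exact h'.symm
    · exact (hR _ _ _ h h').elim

theorem twoLevelOrder_not_lt_lt {Y : Type*} (R : Y → Y → Prop) (hR : ∀ a b c, R a b → ¬ R b c) :
    let _ := twoLevelOrder R hR
    ∀ x y z : Y, x < y → ¬ y < z := by
  intro _ x y z hxy hyz
  exact hR x y z (hxy.le.resolve_left hxy.ne) (hyz.le.resolve_left hyz.ne)

/-- The points of a poset together with a new point for each maximal one. -/
inductive DensityPoint (X : Type u) [PartialOrder X] : Type u
  | old (x : X)
  | new (m : X) (hm : IsMax m)

/-- The points of a set together with an admissible label. -/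
structure SplittingPoint {X : Type u} (V : X → Option Bool → Prop) : Type u where
  /-- the underlying point -/
  pt : X
  /-- the label -/
  label : Option Bool
  valid : V pt label

/-- Every algebra of dimension at most one embeds into one having a witness for (D3). -/
theorem exists_density_extension {M : Type u} [CoheytingAlgebra M] (hM : DimLEOne M) (a : M)
    (ha : a = ⊤ \ (⊤ \ a)) (ha0 : a ≠ ⊥) :
    ∃ (N : Type u) (_ : CoheytingAlgebra N) (f : CoheytingHom M N), Function.Injective f ∧
      DimLEOne N ∧ ∃ b : N, b ≠ ⊥ ∧ f a \ b = f a ∧ b ≤ f a := by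
  obtain ⟨X, _, φ, hφ, hX⟩ := exists_spectrum M hM
  -- Each new point is minimal and lies only below its maximal point `m`; the new points attached
  -- inside `φ a` will form the witness `b`.
  let R : (DensityPoint X) → (DensityPoint X) → Prop := fun y y' => match y, y' with
    | .old x, .old x' => x < x'
    | .new m _, .old x' => m = x'
    | _, .new _ _ => False
  have hR : ∀ y y' y'', R y y' → ¬ R y' y'' := by
    rintro (x | ⟨m, hm⟩) (x' | ⟨m', hm'⟩) (x'' | ⟨m'', hm''⟩) h h'
    · exact hX _ _ _ h h'
    all_goals first | exact False.elim h | exact False.elim h' | skip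
    have h : m = x' := h
    exact hm.not_lt (h ▸ h' : m < x'')
  let π : (DensityPoint X) → X := fun y => match y with
    | .old x => x
    | .new m _ => m
  let _ : PartialOrder (DensityPoint X) := twoLevelOrder R hR
  have hle : ∀ y y' : DensityPoint X, y ≤ y' ↔ y = y' ∨ R y y' := fun _ _ => Iff.rfl
  have hπ : Monotone π := by
    rintro y y' h
    rcases (hle _ _).1 h with rfl | h
    · exact le_rfl
    · rcases y with x | ⟨m, hm⟩ <;> rcases y' with x' | ⟨m', hm'⟩
      · exact (h : x < x').le
      · exact False.elim h
      · exact (h : m = x').le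
      · exact False.elim h
  have lift : ∀ y x, π y ≤ x → ∃ y', y ≤ y' ∧ π y' = x := by
    rintro (x | ⟨m, hm⟩) x' h
    · refine ⟨.old x', (hle _ _).2 ?_, rfl⟩
      rcases (show x ≤ x' from h).eq_or_lt with rfl | h
      · exact Or.inl rfl
      · exact Or.inr h
    · exact ⟨.old x', Or.inr (le_antisymm h (hm h)), rfl⟩
  let ψ := lowerSetComap π hπ lift
  refine ⟨LowerSet (DensityPoint X), inferInstance, ψ.comp φ, ?_, dimLEOne_lowerSet
    (twoLevelOrder_not_lt_lt R hR), ⟨{y | ∃ m hm, y = .new m hm ∧ m ∈ φ a}, ?_⟩,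
    ?_, ?_, ?_⟩
  · exact (lowerSetComap_injective π hπ lift fun x => ⟨.old x, rfl⟩).comp hφ
  · rintro y y' h ⟨m, hmax, rfl, hm⟩
    rcases (hle _ _).1 h with rfl | h
    · exact ⟨m, hmax, rfl, hm⟩
    · rcases y' with x | ⟨m', hm'⟩ <;> exact False.elim h
  · intro h
    have hne : φ a ≠ ⊥ := fun h => ha0 (hφ (h.trans (map_bot φ).symm))
    obtain ⟨x, hx⟩ : ∃ x, x ∈ φ a := by
      by_contra! hc
      exact hne (le_bot_iff.1 fun x hx => (hc x hx).elim)
    -- Regularity of `a` gives a point `y` with everything above it in `φ a`, in particular a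
    -- maximal point of `X`.
    rw [ha, map_sdiff, map_sdiff, map_top, mem_lowerSet_sdiff] at hx
    obtain ⟨y, -, -, hy⟩ := hx
    rw [mem_lowerSet_sdiff] at hy
    push Not at hy
    obtain ⟨m, hm, hmax⟩ : ∃ m, y ≤ m ∧ IsMax m := by
      by_cases hy' : IsMax y
      · exact ⟨y, le_rfl, hy'⟩
      · obtain ⟨m, hm⟩ := not_isMax_iff.1 hy'
        exact ⟨m, hm.le, isMax_iff_forall_not_lt.2 fun z hz => hX _ _ _ hm hz⟩
    have : (.new m hmax : DensityPoint X) ∈ (⊥ : LowerSet (DensityPoint X)) := h ▸ ⟨m, hmax, rfl, hy m hm trivial⟩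
    exact this
  · refine le_antisymm sdiff_le fun y hy => mem_lowerSet_sdiff.2 ?_
    rcases y with x | ⟨m, hm⟩
    · exact ⟨.old x, le_rfl, hy, fun ⟨m, _, h, _⟩ => by cases h⟩
    · exact ⟨.old m, Or.inr rfl, hy, fun ⟨m, _, h, _⟩ => by cases h⟩
  · rintro y ⟨m, hmax, rfl, hm⟩
    exact hm

/-- Every algebra of dimension at most one embeds into one having a witness for (S3). -/
theorem exists_splitting_extension {M : Type u} [CoheytingAlgebra M] (hM : DimLEOne M)
    (a b₁ b₂ : M) (hab : a \ (b₁ ⊔ b₂) = a) (hba : b₁ ⊔ b₂ ≤ a) (ha0 : a ≠ ⊥) :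
    ∃ (N : Type u) (_ : CoheytingAlgebra N) (f : CoheytingHom M N), Function.Injective f ∧
      DimLEOne N ∧ ∃ a₁ a₂ : N, a₁ ≠ ⊥ ∧ a₂ ≠ ⊥ ∧ (f a \ a₂ = a₁ ∧ f b₁ ≤ a₁) ∧
        (f a \ a₁ = a₂ ∧ f b₂ ≤ a₂) ∧ a₁ ⊓ a₂ = f b₁ ⊓ f b₂ := by
  obtain ⟨X, _, φ, hφ, hX⟩ := exists_spectrum M hM
  have hb₁ : φ b₁ ≤ φ a := OrderHomClass.mono φ (le_sup_left.trans hba)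
  have hb₂ : φ b₂ ≤ φ a := OrderHomClass.mono φ (le_sup_right.trans hba)
  -- every point of `a` lies below a point of `a` outside `b₁` and `b₂`, maximal in `a`
  let T : Set X := {x | x ∈ φ a ∧ ∀ y ∈ φ a, ¬ x < y}
  have hT : ∀ x ∈ φ a, ∃ y ∈ T, x ≤ y := fun x hx => by
    by_cases h : x ∈ T
    · exact ⟨x, h, le_rfl⟩
    · have : ∃ y ∈ φ a, x < y := by
        by_contra! hc
        exact h ⟨hx, hc⟩
      obtain ⟨y, hy, hxy⟩ := this
      exact ⟨y, ⟨hy, fun z _ hz => hX _ _ _ hxy hz⟩, hxy.le⟩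
  have hTb : ∀ x ∈ T, x ∉ φ b₁ ∧ x ∉ φ b₂ := fun x hx => by
    have h1 : x ∈ φ a \ (φ b₁ ⊔ φ b₂) := by
      rw [← map_sup, ← map_sdiff, hab]; exact hx.1
    obtain ⟨y, hxy, hya, hyb⟩ := mem_lowerSet_sdiff.1 h1
    rcases hxy.eq_or_lt with rfl | hlt
    · rw [LowerSet.mem_sup_iff, not_or] at hyb
      exact hyb
    · exact (hx.2 y hya hlt).elim
  -- points of `Y` are points of `X` labelled by the parts (`true` for `a₁`) they belong to
  let V : X → Option Bool → Prop := fun x k => match k with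
    | none => x ∉ φ a ∨ (x ∈ φ b₁ ∧ x ∈ φ b₂)
    | some true => x ∈ φ a ∧ x ∉ φ b₂
    -- Points of `T` get both labels; a point of `a` outside `b₁`, `b₂` and `T` only gets `true`.
    | some false => x ∈ φ a ∧ x ∉ φ b₁ ∧ (x ∈ T ∨ x ∈ φ b₂)
  have hV : ∀ x, ∃ k, V x k := fun x => by
    by_cases h1 : x ∈ φ a
    · by_cases h2 : x ∈ φ b₂
      · by_cases h3 : x ∈ φ b₁
        · exact ⟨none, Or.inr ⟨h3, h2⟩⟩
        · exact ⟨some false, h1, h3, Or.inr h2⟩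
      · exact ⟨some true, h1, h2⟩
    · exact ⟨none, Or.inl h1⟩
  have hVT : ∀ x ∈ T, ∀ k : Bool, V x (some k) := fun x hx k => by
    cases k
    · exact ⟨hx.1, (hTb x hx).1, Or.inl hx⟩
    · exact ⟨hx.1, (hTb x hx).2⟩
  -- The label `none` is compatible with both others, while the copies labelled `true` and `false`
  -- are unrelated.
  let R : (SplittingPoint V) → (SplittingPoint V) → Prop := fun y y' => y.pt < y'.pt ∧
    (y.label = y'.label ∨ y.label = none ∨ y'.label = none)
  have hR : ∀ y y' y'', R y y' → ¬ R y' y'' := fun y y' y'' h h' => hX _ _ _ h.1 h'.1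
  let π : (SplittingPoint V) → X := fun y => y.pt
  let _ : PartialOrder (SplittingPoint V) := twoLevelOrder R hR
  have hle : ∀ y y' : SplittingPoint V, y ≤ y' ↔ y = y' ∨ R y y' := fun _ _ => Iff.rfl
  have hπ : Monotone π := by
    rintro y y' h
    rcases (hle _ _).1 h with rfl | h
    · exact le_rfl
    · exact h.1.le
  have lift' : ∀ (y : SplittingPoint V) x, x ∈ T → y.pt ∈ φ a → y.pt < x → ∀ k : Bool,
      (y.label = some k ∨ y.label = none) → ∃ y' : SplittingPoint V, R y y' ∧ y'.pt = x ∧ y'.label = some k :=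
    fun y x hx _ hlt k hk => ⟨⟨x, some k, hVT x hx k⟩, ⟨hlt, hk.imp id Or.inl⟩, rfl, rfl⟩
  have lift : ∀ y x, π y ≤ x → ∃ y', y ≤ y' ∧ π y' = x := by
    rintro y x h
    rcases h.eq_or_lt with rfl | hlt
    · exact ⟨y, le_rfl, rfl⟩
    · by_cases hx : x ∈ φ a
      · have hxT : x ∈ T := ⟨hx, fun z _ hz => hX _ _ _ hlt hz⟩
        obtain ⟨k, hk⟩ : ∃ k : Bool, y.label = some k ∨ y.label = none := by
          rcases y.label with _ | k
          · exact ⟨true, Or.inr rfl⟩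
          · exact ⟨k, Or.inl rfl⟩
        obtain ⟨y', hy', e⟩ := lift' y x hxT ((φ a).lower hlt.le hx) hlt k hk
        exact ⟨y', Or.inr hy', e.1⟩
      · exact ⟨⟨x, none, Or.inl hx⟩, Or.inr ⟨hlt, Or.inr (Or.inr rfl)⟩, rfl⟩
  let ψ := lowerSetComap π hπ lift
  -- the two parts
  let P : Bool → LowerSet (SplittingPoint V) := fun k => ⟨{y | y.pt ∈ φ a ∧ (y.label = some k ∨ y.label = none)}, by
    rintro y y' h ⟨hy, hk⟩
    rcases (hle _ _).1 h with rfl | h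
    · exact ⟨hy, hk⟩
    · refine ⟨(φ a).lower h.1.le hy, ?_⟩
      rcases h.2 with h2 | h2 | h2
      · rwa [h2]
      · exact Or.inr h2
      -- An unlabelled point of `a` lies in `b₁`; having a point strictly below it, it is also in
      -- `T`, which avoids `b₁`.
      · exfalso
        have h3 : V y.pt y.label := y.valid
        rw [h2] at h3
        rcases h3 with h3 | h3
        · exact h3 hy
        · have hyT : y.pt ∈ T := ⟨hy, fun z _ hz => hX _ _ _ h.1 hz⟩
          exact (hTb _ hyT).1 h3.1⟩
  have hP : ∀ k y, y ∈ P k ↔ y.pt ∈ φ a ∧ (y.label = some k ∨ y.label = none) :=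
    fun _ _ => Iff.rfl
  have hPne : ∀ k, P k ≠ ⊥ := fun k h => by
    have hne : φ a ≠ ⊥ := fun h => ha0 (hφ (h.trans (map_bot φ).symm))
    obtain ⟨x, hx⟩ : ∃ x, x ∈ φ a := by
      by_contra! hc
      exact hne (le_bot_iff.1 fun x hx => (hc x hx).elim)
    obtain ⟨m, hm, -⟩ := hT x hx
    have : (⟨m, some k, hVT m hm k⟩ : SplittingPoint V) ∈ (⊥ : LowerSet (SplittingPoint V)) := by
      rw [← h, hP]; exact ⟨hm.1, Or.inl rfl⟩
    exact this
  have hPsd : ∀ k, ψ (φ a) \ P (!k) = P k := fun k => by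
    ext y
    change y ∈ ψ (φ a) \ P (!k) ↔ y ∈ P k
    rw [mem_lowerSet_sdiff, hP]
    constructor
    · rintro ⟨y', hy, hya, hyP⟩
      have hk : y'.label = some k := by
        rw [hP, not_and, not_or] at hyP
        obtain ⟨h1, h2⟩ := hyP hya
        rcases h : y'.label with _ | l
        · exact (h2 h).elim
        · rw [h] at h1
          congr 1
          cases k <;> cases l <;> simp_all
      exact (P k).lower hy ((hP _ _).2 ⟨hya, Or.inl hk⟩)
    · rintro ⟨hya, hk⟩
      obtain ⟨m, hm, hym⟩ := hT _ hya
      have hnot : ∀ y' : SplittingPoint V, y'.label = some k → y' ∉ P (!k) := fun y' h h' => by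
        rcases ((hP _ _).1 h').2 with h2 | h2 <;> rw [h] at h2 <;> simp at h2
      rcases hym.eq_or_lt with e | hlt
      · refine ⟨y, le_rfl, hya, hnot y (hk.resolve_right fun h => ?_)⟩
        have h3 : V y.pt y.label := y.valid
        rw [h] at h3
        rcases h3 with h3 | h3
        · exact h3 hya
        · exact (hTb _ hm).1 (e ▸ h3.1)
      · obtain ⟨y', hy', e⟩ := lift' y m hm hya hlt k hk
        refine ⟨y', Or.inr hy', ?_, hnot y' (e.2)⟩
        exact (congrArg (· ∈ φ a) e.1).mpr hm.1
  have hPb : ∀ y : SplittingPoint V, y.pt ∈ φ b₁ → y ∈ P true := fun y hy => by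
    refine (hP _ _).2 ⟨hb₁ hy, ?_⟩
    have h3 : V y.pt y.label := y.valid
    rcases h : y.label with _ | k
    · exact Or.inr rfl
    · rw [h] at h3
      cases k
      · exact (h3.2.1 hy).elim
      · exact Or.inl rfl
  have hPb' : ∀ y : SplittingPoint V, y.pt ∈ φ b₂ → y ∈ P false := fun y hy => by
    refine (hP _ _).2 ⟨hb₂ hy, ?_⟩
    have h3 : V y.pt y.label := y.valid
    rcases h : y.label with _ | k
    · exact Or.inr rfl
    · rw [h] at h3
      cases k
      · exact Or.inl rfl
      · exact (h3.2 hy).elim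
  refine ⟨LowerSet (SplittingPoint V), inferInstance, ψ.comp φ, ?_, dimLEOne_lowerSet
    (twoLevelOrder_not_lt_lt R hR), P true, P false, hPne _, hPne _, ⟨hPsd true, hPb⟩,
    ⟨hPsd false, hPb'⟩, ?_⟩
  · refine (lowerSetComap_injective π hπ lift fun x => ?_).comp hφ
    obtain ⟨k, hk⟩ := hV x
    exact ⟨⟨x, k, hk⟩, rfl⟩
  · refine le_antisymm (fun y hy => ?_) (inf_le_inf hPb hPb')
    obtain ⟨⟨hya, h1⟩, -, h2⟩ := LowerSet.mem_inf_iff.1 hy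
    have h : y.label = none := by
      rcases h1 with h1 | h1
      · rw [h1] at h2; simp at h2
      · exact h1
    have h3 : V y.pt y.label := y.valid
    rw [h] at h3
    exact LowerSet.mem_inf_iff.2 (h3.resolve_left fun h => h hya)

end Extension

end CoHeyting

/-! ### A compactness criterion for quantifier elimination -/

namespace ModelCompletion

variable {L : FirstOrder.Language.{0, 0}}

/-- Compactness for the consequences of a set of formulas modulo a theory. -/
theorem exists_list_of_forall_realize (T : L.Theory) {α : Type} (Γ : Set (L.Formula α))
    (φ : L.Formula α)
    (h : ∀ (M : Theory.ModelType.{0, 0, 0} T) (v : α → M), (∀ ψ ∈ Γ, ψ.Realize v) → φ.Realize v) :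
    ∃ l : List (L.Formula α), (∀ ψ ∈ l, ψ ∈ Γ) ∧
      ∀ (M : Theory.ModelType.{0, 0, 0} T) (v : α → M),
        (∀ ψ ∈ l, ψ.Realize v) → φ.Realize v := by
  classical
  let T' : L[[α]].Theory := (L.lhomWithConstants α).onTheory T
  have h1 : (T' ∪ Formula.equivSentence '' Γ) ⊨ᵇ Formula.equivSentence φ := by
    refine Theory.models_sentence_iff.2 fun M => ?_
    let _ := (L.lhomWithConstants α).reduct M
    have hM := (Theory.model_iff _).1 M.is_model
    have hMT' : M ⊨ T' := (Theory.model_iff _).2 fun ψ hψ => hM ψ (Or.inl hψ)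
    have hMT : M ⊨ T := (LHom.onTheory_model _ _).1 hMT'
    rw [Formula.realize_equivSentence]
    exact h (Theory.ModelType.of T M) (fun a => (L.con a : M)) fun ψ hψ =>
      (Formula.realize_equivSentence M ψ).1 (hM _ (Or.inr ⟨ψ, hψ, rfl⟩))
  obtain ⟨T0, hT0, h2⟩ := Theory.models_iff_finset_models.1 h1
  refine ⟨((T0.filter fun s => Formula.equivSentence.symm s ∈ Γ).image
    Formula.equivSentence.symm).toList, fun ψ hψ => ?_, fun M v hv => ?_⟩
  · simp only [Finset.mem_toList, Finset.mem_image, Finset.mem_filter] at hψ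
    obtain ⟨s, hs, rfl⟩ := hψ
    exact hs.2
  · let _ : (constantsOn α).Structure M := constantsOn.structure v
    have hMT' : M ⊨ T' := (LHom.onTheory_model _ _).2 inferInstance
    have hM0 : M ⊨ (T0 : L[[α]].Theory) := (Theory.model_iff _).2 fun s hs => by
      rcases hT0 hs with h | ⟨ψ, hψ, rfl⟩
      · exact (Theory.model_iff _).1 hMT' s h
      · refine (Formula.realize_equivSentence M ψ).2 (hv ψ ?_)
        simp only [Finset.mem_toList, Finset.mem_image, Finset.mem_filter]
        exact ⟨_, ⟨hs, by simpa using hψ⟩, by simp⟩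
    exact (Formula.realize_equivSentence M φ).1 (h2.realize_sentence M)

theorem isQF_foldr_inf {α : Type} (l : List (L.Formula α))
    (hl : ∀ ψ ∈ l, BoundedFormula.IsQF ψ) : BoundedFormula.IsQF (l.foldr (· ⊓ ·) ⊤) := by
  induction l with
  | nil => exact BoundedFormula.IsQF.top
  | cons ψ l ih =>
    exact (hl ψ (by simp)).inf (ih fun χ hχ => hl χ (by simp [hχ]))

theorem realize_foldr_inf {α : Type} {M : Type*} [L.Structure M] (l : List (L.Formula α))
    (v : α → M) :
    Formula.Realize (l.foldr (· ⊓ ·) ⊤ : L.Formula α) v ↔ ∀ ψ ∈ l, ψ.Realize v :=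
  BoundedFormula.realize_foldr_inf l v default

/-- A theory all of whose formulas are preserved between tuples with the same quantifier-free type
eliminates quantifiers. -/
theorem hasQuantifierElimination_of_realize_iff (T : L.Theory)
    (h : ∀ (n : ℕ) (φ : L.Formula (Fin n)) (M N : Theory.ModelType.{0, 0, 0} T)
      (v : Fin n → M) (w : Fin n → N),
      (∀ ψ : L.Formula (Fin n), BoundedFormula.IsQF ψ → (ψ.Realize v ↔ ψ.Realize w)) →
        (φ.Realize v ↔ φ.Realize w)) : HasQuantifierElimination T := by
  intro n φ
  -- First use of compactness: the quantifier-free type of a tuple satisfying `φ` entails `φ`, so a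
  -- single formula of it does.
  have h1 : ∀ (M : Theory.ModelType.{0, 0, 0} T) (v : Fin n → M), φ.Realize v →
      ∃ ψ : L.Formula (Fin n), BoundedFormula.IsQF ψ ∧ ψ.Realize v ∧
        ∀ (N : Theory.ModelType.{0, 0, 0} T) (w : Fin n → N), ψ.Realize w → φ.Realize w := by
    intro M v hv
    obtain ⟨l, hl, hl'⟩ := exists_list_of_forall_realize T
      {ψ : L.Formula (Fin n) | BoundedFormula.IsQF ψ ∧ ψ.Realize v} φ fun N w hw =>
        (h n φ M N v w fun ψ hψ => ⟨fun hv => hw ψ ⟨hψ, hv⟩, fun hw' => by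
          by_contra hv
          exact (Formula.realize_not.1 (hw ψ.not ⟨hψ.not, Formula.realize_not.2 hv⟩)) hw'⟩).1 hv
    exact ⟨l.foldr (· ⊓ ·) ⊤, isQF_foldr_inf l fun ψ hψ => (hl ψ hψ).1,
      (realize_foldr_inf l v).2 fun ψ hψ => (hl ψ hψ).2,
      fun N w hw => hl' N w ((realize_foldr_inf l w).1 hw)⟩
  -- Second use: the negations of all quantifier-free formulas implying `φ` together entail the
  -- negation of `φ`, so finitely many suffice.
  obtain ⟨l, hl, hl'⟩ := exists_list_of_forall_realize T
    {χ : L.Formula (Fin n) | BoundedFormula.IsQF χ ∧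
      ∀ (N : Theory.ModelType.{0, 0, 0} T) (w : Fin n → N), ¬ χ.Realize w → φ.Realize w} φ.not
    fun M v hv => Formula.realize_not.2 fun hφ => by
      obtain ⟨ψ, hψ, hψv, hψφ⟩ := h1 M v hφ
      exact Formula.realize_not.1 (hv ψ.not ⟨hψ.not, fun N w hw => hψφ N w (by
        rwa [Formula.realize_not, not_not] at hw)⟩) hψv
  refine ⟨Formula.not (l.foldr (· ⊓ ·) ⊤),
    (isQF_foldr_inf l fun ψ hψ => (hl ψ hψ).1).not, ?_⟩
  refine Theory.models_formula_iff.2 fun M v => ?_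
  refine Formula.realize_iff.2 ⟨fun hφ => Formula.realize_not.2 fun hv => ?_, fun hv => ?_⟩
  · exact Formula.realize_not.1 (hl' M v ((realize_foldr_inf l v).1 hv)) hφ
  · rw [Formula.realize_not, realize_foldr_inf] at hv
    push Not at hv
    obtain ⟨ψ, hψ, hψv⟩ := hv
    exact (hl ψ hψ).2 M v hψv

end ModelCompletion

namespace CoHeyting

attribute [local instance] toStructure

/-! ### Homomorphisms and subalgebras as first-order structures -/

section Hom

variable {M N : Type*} [CoheytingAlgebra M] [CoheytingAlgebra N]

/-- An injective homomorphism of co-Heyting algebras as an embedding of structures. -/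
def homToEmbedding (f : CoheytingHom M N) (hf : Function.Injective f) : M ↪[lang] N where
  toFun := f
  inj' := hf
  map_fun' F x := by
    cases F with
    | bot => exact map_bot f
    | top => exact map_top f
    | sup => exact map_sup f _ _
    | inf => exact map_inf f _ _
    | sdiff => exact map_sdiff f _ _
  map_rel' r := r.elim

/-- An embedding of structures as a homomorphism of co-Heyting algebras. -/
def embeddingToHom (f : M ↪[lang] N) : CoheytingHom M N where
  toFun := f
  map_sup' a b := f.map_fun (Func.sup : lang.Functions 2) ![a, b]
  map_inf' a b := f.map_fun (Func.inf : lang.Functions 2) ![a, b]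
  map_top' := f.map_fun (Func.top : lang.Functions 0) ![]
  map_sdiff' a b := f.map_fun (Func.sdiff : lang.Functions 2) ![a, b]

theorem realize_hom (f : CoheytingHom M N) (hf : Function.Injective f) {β : Type} (v : β → M)
    (t : lang.Term β) : t.realize (fun b => f (v b)) = f (t.realize v) :=
  HomClass.realize_term (homToEmbedding f hf) (v := v)

/-- A subset closed under the operations is a co-Heyting algebra. -/
theorem exists_subalgebra (S : Set M) (hb : ⊥ ∈ S) (ht : ⊤ ∈ S)
    (h : ∀ a ∈ S, ∀ b ∈ S, a ⊔ b ∈ S ∧ a ⊓ b ∈ S ∧ a \ b ∈ S) :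
    ∃ (_ : CoheytingAlgebra S) (f : CoheytingHom S M), ∀ x, f x = x := by
  let A : CoheytingAlgebra S :=
    { (inferInstance : PartialOrder S) with
      sup := fun a b => ⟨a ⊔ b, (h a a.2 b b.2).1⟩
      le_sup_left := fun a b => (le_sup_left : (a : M) ≤ (a : M) ⊔ (b : M))
      le_sup_right := fun a b => (le_sup_right : (b : M) ≤ (a : M) ⊔ (b : M))
      sup_le := fun a b c h h' => (sup_le h h' : (a : M) ⊔ (b : M) ≤ c)
      inf := fun a b => ⟨a ⊓ b, (h a a.2 b b.2).2.1⟩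
      inf_le_left := fun a b => (inf_le_left : (a : M) ⊓ (b : M) ≤ a)
      inf_le_right := fun a b => (inf_le_right : (a : M) ⊓ (b : M) ≤ b)
      le_inf := fun a b c h h' => (le_inf h h' : (a : M) ≤ (b : M) ⊓ (c : M))
      top := ⟨⊤, ht⟩
      le_top := fun a => (le_top : (a : M) ≤ ⊤)
      bot := ⟨⊥, hb⟩
      bot_le := fun a => (bot_le : ⊥ ≤ (a : M))
      sdiff := fun a b => ⟨a \ b, (h a a.2 b b.2).2.2⟩
      hnot := fun a => ⟨⊤ \ a, (h ⊤ ht a a.2).2.2⟩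
      sdiff_le_iff := fun a b c => (sdiff_le_iff : (a : M) \ b ≤ c ↔ _)
      top_sdiff := fun _ => rfl }
  exact ⟨A, ⟨⟨⟨Subtype.val, fun _ _ => rfl⟩, fun _ _ => rfl⟩, rfl, fun _ _ => rfl⟩, fun _ => rfl⟩

theorem realize_hom_of_isQF (f : CoheytingHom M N) (hf : Function.Injective f) {β : Type}
    {φ : lang.Formula β} (hφ : BoundedFormula.IsQF φ) (v : β → M) :
    φ.Realize (fun b => f (v b)) ↔ φ.Realize v := by
  rw [Formula.Realize, Formula.Realize, ← hφ.realize_embedding (homToEmbedding f hf),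
    Subsingleton.elim (homToEmbedding f hf ∘ default) default]
  rfl

theorem exists_factor {A : Type*} [CoheytingAlgebra A] (f : CoheytingHom A M)
    (k : CoheytingHom N M) (hk : Function.Injective k) (h : ∀ a, ∃ b, k b = f a) :
    ∃ i : CoheytingHom A N, ∀ a, k (i a) = f a := by
  choose i hi using h
  exact ⟨⟨⟨⟨i, fun a b => hk (by rw [map_sup, hi, hi, hi, map_sup])⟩,
    fun a b => hk (by change k (i _) = k (i _ ⊓ i _); rw [map_inf, hi, hi, hi, map_inf])⟩,
    hk (by change k (i _) = k ⊤; rw [hi, map_top, map_top]),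
    fun a b => hk (by change k (i _) = k (i _ \ i _); rw [map_sdiff, hi, hi, hi, map_sdiff])⟩, hi⟩

end Hom

theorem models_axioms_iff (M : Type u) [CoheytingAlgebra M] :
    M ⊨ theoryV3 ∪ {densityD3, splittingS3} ↔ DimLEOne M ∧ Density M ∧ Splitting M := by
  have h := models_V3_iff M
  have hD := models_D3_iff M
  have hS := models_S3_iff M
  rw [Theory.model_iff] at h ⊢
  simp only [Set.mem_union, Set.mem_insert_iff, Set.mem_singleton_iff, or_imp, forall_and,
    forall_eq, hD, hS, h]
  rfl

theorem model_V1_of_V3 (M : Type u) [lang.Structure M] (h : M ⊨ theoryV3) : M ⊨ theoryV1 :=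
  Theory.Model.mono h Set.subset_union_left

/-! ### Existentially closed algebras satisfy (D3) and (S3) -/

section Witnesses

theorem exists_witness_of_isExistentiallyClosed {M N : Type u} [CoheytingAlgebra M]
    [CoheytingAlgebra N] (hM : ModelCompletion.IsExistentiallyClosed theoryV3 M)
    (hN : DimLEOne N) (f : CoheytingHom M N) (hf : Function.Injective f) {m n : ℕ}
    (φ : lang.Formula (Fin m ⊕ Fin n)) (hφ : BoundedFormula.IsQF φ) (a : Fin m → M)
    (b : Fin n → N) (h : φ.Realize (Sum.elim (f ∘ a) b)) : ∃ b, φ.Realize (Sum.elim a b) :=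
  hM.2 N ((models_V3_iff N).2 hN) (homToEmbedding f hf) m n φ hφ a ⟨b, h⟩

theorem isQF_equal {α : Type} (s t : lang.Term α) : BoundedFormula.IsQF (s.equal t) :=
  (BoundedFormula.IsAtomic.equal _ _).isQF

theorem density_of_isExistentiallyClosed {M : Type u} [CoheytingAlgebra M]
    (hM : ModelCompletion.IsExistentiallyClosed theoryV3 M) : Density M := by
  rintro a ⟨ha, ha0⟩
  obtain ⟨N, _, f, hf, hN, b, hb, hab, hba⟩ :=
    exists_density_extension ((models_V3_iff M).1 hM.1) a ha ha0
  let x : lang.Term (Fin 1 ⊕ Fin 1) := Term.var (.inl 0)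
  let y : lang.Term (Fin 1 ⊕ Fin 1) := Term.var (.inr 0)
  obtain ⟨b', h⟩ := exists_witness_of_isExistentiallyClosed hM hN f hf
    (Formula.not (y.equal ⊥) ⊓ ((x \ y).equal x ⊓ (y ⊔ x).equal x))
    ((isQF_equal _ _).not.inf ((isQF_equal _ _).inf (isQF_equal _ _))) ![a] ![b] (by
      simp only [Formula.realize_inf, Formula.realize_not, Formula.realize_equal, realize_bot,
        realize_sdiff, realize_sup, sup_eq_right]
      exact ⟨hb, hab, hba⟩)
  simp only [Formula.realize_inf, Formula.realize_not, Formula.realize_equal, realize_bot,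
    realize_sdiff, realize_sup, sup_eq_right] at h
  exact ⟨b' 0, h⟩

theorem splitting_of_isExistentiallyClosed {M : Type u} [CoheytingAlgebra M]
    (hM : ModelCompletion.IsExistentiallyClosed theoryV3 M) : Splitting M := by
  rintro a b₁ b₂ ⟨⟨hab, hba⟩, ha0⟩
  obtain ⟨N, _, f, hf, hN, a₁, a₂, h⟩ :=
    exists_splitting_extension ((models_V3_iff M).1 hM.1) a b₁ b₂ hab hba ha0
  let x : Fin 3 → lang.Term (Fin 3 ⊕ Fin 2) := fun i => Term.var (.inl i)
  let y : Fin 2 → lang.Term (Fin 3 ⊕ Fin 2) := fun i => Term.var (.inr i)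
  obtain ⟨c, h'⟩ := exists_witness_of_isExistentiallyClosed hM hN f hf
    (Formula.not ((y 0).equal ⊥) ⊓ (Formula.not ((y 1).equal ⊥) ⊓
      (((x 0 \ y 1).equal (y 0) ⊓ (x 1 ⊔ y 0).equal (y 0)) ⊓
      (((x 0 \ y 0).equal (y 1) ⊓ (x 2 ⊔ y 1).equal (y 1)) ⊓
        (y 0 ⊓ y 1).equal (x 1 ⊓ x 2)))))
    ((isQF_equal _ _).not.inf ((isQF_equal _ _).not.inf
      (((isQF_equal _ _).inf (isQF_equal _ _)).inf
        (((isQF_equal _ _).inf (isQF_equal _ _)).inf (isQF_equal _ _)))))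
    ![a, b₁, b₂] ![a₁, a₂] (by
      simp only [Formula.realize_inf, Formula.realize_not, Formula.realize_equal, realize_bot,
        realize_sdiff, realize_sup, realize_inf, sup_eq_right]
      exact h)
  simp only [Formula.realize_inf, Formula.realize_not, Formula.realize_equal, realize_bot,
    realize_sdiff, realize_sup, realize_inf, sup_eq_right] at h'
  exact ⟨c 0, c 1, h'⟩

end Witnesses

/-! ### Models of the axioms are existentially closed -/

section Closed

/-- Parameters and solution lie in a finite subalgebra `S` of `N`. Its trace on `M` is a finite
algebra containing the parameters, and `S` re-embeds into `M` over that trace. -/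
theorem isExistentiallyClosed_of_axioms {M : Type u} [CoheytingAlgebra M] (hM : DimLEOne M)
    (hD : Density M) (hS : Splitting M) :
    ModelCompletion.IsExistentiallyClosed theoryV3 M := by
  refine ⟨(models_V3_iff M).2 hM, ?_⟩
  rintro N SN hN f m n φ hφ a ⟨b, hb⟩
  obtain ⟨_, rfl⟩ := exists_coheyting N (model_V1_of_V3 N hN)
  have hN' : DimLEOne N := (models_V3_iff N).1 hN
  let F := embeddingToHom f
  have hF : Function.Injective F := f.injective
  let v : Fin m ⊕ Fin n → N := Sum.elim (f ∘ a) b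
  obtain ⟨S, hSf, hvS, hbot, htop, hcl⟩ := exists_finite_closed hN' v
  have : Finite S := hSf
  obtain ⟨_, k, hk⟩ := exists_subalgebra S hbot htop hcl
  have hkinj : Function.Injective k := fun x y h => Subtype.ext (by rw [← hk, ← hk, h])
  obtain ⟨_, j, hj⟩ := exists_subalgebra (F ⁻¹' S) (by simpa using hbot) (by simpa using htop)
    (fun x hx y hy => by
      simp only [Set.mem_preimage, map_sup, map_inf, map_sdiff]
      exact hcl _ hx _ hy)
  have : Finite (F ⁻¹' S : Set M) := hSf.preimage hF.injOn
  have hjinj : Function.Injective j := fun x y h => Subtype.ext (by rw [← hj, ← hj, h])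
  obtain ⟨i, hi⟩ := exists_factor (F.comp j) k hkinj fun x => ⟨⟨F x, x.2⟩, by
    rw [hk, CoheytingHom.comp_apply, hj]⟩
  have hiinj : Function.Injective i := fun x y h => hjinj (hF (by
    have := congrArg k h
    rwa [hi, hi] at this))
  obtain ⟨h, hinj, hh⟩ := exists_extension (hN'.of_injective k hkinj) hD hS i hiinj j hjinj
  let s : Fin m ⊕ Fin n → S := fun x => ⟨v x, hvS x⟩
  have h1 : φ.Realize s := by
    rw [← realize_hom_of_isQF k hkinj hφ, funext fun x => hk (s x)]
    exact hb
  refine ⟨fun x => h (s (.inr x)), ?_⟩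
  have e : Sum.elim a (fun x => h (s (.inr x))) = fun x => h (s x) := by
    funext x
    rcases x with x | x
    · have hx : a x ∈ F ⁻¹' S := hvS (.inl x)
      have e : s (.inl x) = i ⟨a x, hx⟩ := hkinj (by
        rw [hi, hk, CoheytingHom.comp_apply, hj]; rfl)
      change a x = h (s (.inl x))
      rw [e, hh, hj]
    · rfl
  rw [e, realize_hom_of_isQF h hinj hφ]
  exact h1

end Closed

/-! ### Back-and-forth between models -/

section BackAndForth

/-- Two tuples satisfy the same term equations. -/
def SameEquations {β M N : Type*} [lang.Structure M] [lang.Structure N] (v : β → M) (w : β → N) :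
    Prop :=
  ∀ s t : lang.Term β, s.realize v = t.realize v ↔ s.realize w = t.realize w

/-- The subalgebra `R` generated by the old tuple is finite and, as the equations agree, embeds into
`N` by evaluating terms at `w`. A finite algebra `S` containing the longer tuple then embeds over
`R`. -/
theorem SameEquations.exists_extension {M : Type u} {N : Type u} [CoheytingAlgebra M]
    [CoheytingAlgebra N] (hM : DimLEOne M) (hD : Density N) (hS : Splitting N)
    {β γ : Type} [Finite γ] (σ : β → γ) (v : γ → M) (w : β → N)
    (h : SameEquations (v ∘ σ) w) : ∃ w' : γ → N, w' ∘ σ = w ∧ SameEquations v w' := by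
  obtain ⟨S, hSf, hvS, hbot, htop, hcl⟩ := exists_finite_closed hM v
  have : Finite S := hSf
  obtain ⟨_, k, hk⟩ := exists_subalgebra S hbot htop hcl
  have hkinj : Function.Injective k := fun x y h => Subtype.ext (by rw [← hk, ← hk, h])
  let s : γ → S := fun x => ⟨v x, hvS x⟩
  have hks : ∀ t : lang.Term γ, t.realize v = k (t.realize s) := fun t => by
    rw [← realize_hom k hkinj]
    exact congrArg (fun u => t.realize u) (funext fun x => (hk (s x)).symm)
  have hrS : ∀ t : lang.Term β, t.realize (v ∘ σ) ∈ S := fun t => by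
    rw [← Term.realize_relabel, hks, hk]
    exact Subtype.mem _
  let R : Set M := Set.range fun t : lang.Term β => t.realize (v ∘ σ)
  have hRS : R ⊆ S := by rintro _ ⟨t, rfl⟩; exact hrS t
  obtain ⟨_, j, hj⟩ := exists_subalgebra R ⟨⊥, rfl⟩ ⟨⊤, rfl⟩ (by
    rintro _ ⟨t, rfl⟩ _ ⟨t', rfl⟩
    exact ⟨⟨t ⊔ t', rfl⟩, ⟨t ⊓ t', rfl⟩, ⟨t \ t', rfl⟩⟩)
  have : Finite R := hSf.subset hRS
  have hjinj : Function.Injective j := fun x y h => Subtype.ext (by rw [← hj, ← hj, h])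
  obtain ⟨i, hi⟩ := exists_factor j k hkinj fun x => ⟨⟨x, hRS x.2⟩, by rw [hk, hj]⟩
  have hiinj : Function.Injective i := fun x y h => hjinj (by rw [← hi, ← hi, h])
  have hτ : ∀ x : R, ∃ t : lang.Term β, t.realize (v ∘ σ) = x := fun x => x.2
  choose τ hτ using hτ
  have hf : ∀ (x : R) (t : lang.Term β), t.realize (v ∘ σ) = j x →
      (τ x).realize w = t.realize w := fun x t ht => (h _ _).1 (by rw [hτ, ht, hj])
  have hj' : ∀ x, j x = (τ x).realize (v ∘ σ) := fun x => by rw [hτ, hj]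
  let f : CoheytingHom R N := ⟨⟨⟨fun x => (τ x).realize w,
    fun x y => hf _ (τ x ⊔ τ y) (by rw [map_sup, realize_sup, hj', hj'])⟩,
    fun x y => hf _ (τ x ⊓ τ y) (by
      rw [realize_inf, ← hj', ← hj']; exact (map_inf j x y).symm)⟩,
    hf _ ⊤ (map_top j).symm,
    fun x y => hf _ (τ x \ τ y) (by
      rw [realize_sdiff, ← hj', ← hj']; exact (map_sdiff j x y).symm)⟩
  have hfinj : Function.Injective f := fun x y hxy => hjinj (by
    rw [hj', hj']; exact (h _ _).2 hxy)
  obtain ⟨g, hg, hgf⟩ := CoHeyting.exists_extension (hM.of_injective k hkinj) hD hS i hiinj f hfinj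
  refine ⟨fun x => g (s x), funext fun b => ?_, fun t t' => ?_⟩
  · have hb : v (σ b) ∈ R := ⟨Term.var b, rfl⟩
    have e : s (σ b) = i ⟨v (σ b), hb⟩ := hkinj (by rw [hi, hk, hj])
    change g (s (σ b)) = w b
    rw [e, hgf]
    exact hf _ (Term.var b) (by rw [hj]; rfl)
  · rw [realize_hom g hg, realize_hom g hg, hks, hks, hkinj.eq_iff, hg.eq_iff]

/-- Atomic formulas are equations, and a quantifier is handled by extending the tuple on either side
by one element. -/
theorem SameEquations.realize_iff {α : Type} [Finite α] {n : ℕ} (φ : lang.BoundedFormula α n)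
    {M : Type u} {N : Type u} [CoheytingAlgebra M] [CoheytingAlgebra N]
    (hM : DimLEOne M ∧ Density M ∧ Splitting M) (hN : DimLEOne N ∧ Density N ∧ Splitting N)
    (v : α → M) (w : α → N) (xs : Fin n → M) (ys : Fin n → N)
    (h : SameEquations (Sum.elim v xs) (Sum.elim w ys)) :
    φ.Realize v xs ↔ φ.Realize w ys := by
  induction φ with
  | falsum => rfl
  | equal s t => exact h s t
  | rel r => exact r.elim
  | imp φ ψ ih₁ ih₂ =>
    rw [BoundedFormula.realize_imp, BoundedFormula.realize_imp, ih₁ xs ys h, ih₂ xs ys h]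
  | @all n φ ih =>
    rw [BoundedFormula.realize_all, BoundedFormula.realize_all]
    let σ : α ⊕ Fin n → α ⊕ Fin (n + 1) := Sum.map id Fin.castSucc
    have hσ : ∀ {P : Type u} (v : α → P) (xs : Fin n → P) (c : P),
        Sum.elim v (Fin.snoc xs c : Fin (n + 1) → P) ∘ σ = Sum.elim v xs := by
      intro P v xs c
      funext x
      rcases x with x | x
      · rfl
      · simp [σ]
    have hσ' : ∀ {P : Type u} (v : α → P) (xs : Fin n → P) (u : α ⊕ Fin (n + 1) → P),
        u ∘ σ = Sum.elim v xs → ∃ c, u = Sum.elim v (Fin.snoc xs c : Fin (n + 1) → P) := by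
      intro P v xs u hu
      refine ⟨u (.inr (Fin.last n)), funext fun x => ?_⟩
      rcases x with x | x
      · exact congrFun hu (.inl x)
      · induction x using Fin.lastCases with
        | last => simp
        | cast x => simpa [σ] using congrFun hu (.inr x)
    constructor
    · intro hv d
      obtain ⟨u, hu, hu'⟩ := SameEquations.exists_extension hN.1 hM.2.1 hM.2.2 σ
        (Sum.elim w (Fin.snoc ys d : Fin (n + 1) → N)) (Sum.elim v xs)
        (by rw [hσ]; exact fun s t => (h s t).symm)
      obtain ⟨c, rfl⟩ := hσ' _ _ _ hu
      exact (ih _ _ fun s t => (hu' s t).symm).1 (hv c)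
    · intro hv c
      obtain ⟨u, hu, hu'⟩ := SameEquations.exists_extension hM.1 hN.2.1 hN.2.2 σ
        (Sum.elim v (Fin.snoc xs c : Fin (n + 1) → M)) (Sum.elim w ys) (by rw [hσ]; exact h)
      obtain ⟨d, rfl⟩ := hσ' _ _ _ hu
      exact (ih _ _ hu').2 (hv d)

end BackAndForth

end CoHeyting

/-! ### The model completion -/

theorem mainTheorem1 :
    ModelCompletion.IsModelCompletion.{u} CoHeyting.theoryV3
      (CoHeyting.theoryV3 ∪ {CoHeyting.densityD3, CoHeyting.splittingS3}) := by
  refine ⟨fun M S _ => ⟨fun h => ?_, fun h => ?_⟩,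
    ModelCompletion.hasQuantifierElimination_of_realize_iff _ fun n φ M N v w h => ?_⟩
  · obtain ⟨_, rfl⟩ := CoHeyting.exists_coheyting M
      (CoHeyting.model_V1_of_V3 M (Theory.Model.mono h Set.subset_union_left))
    obtain ⟨h1, h2, h3⟩ := (CoHeyting.models_axioms_iff M).1 h
    exact CoHeyting.isExistentiallyClosed_of_axioms h1 h2 h3
  · obtain ⟨_, rfl⟩ := CoHeyting.exists_coheyting M (CoHeyting.model_V1_of_V3 M h.1)
    exact (CoHeyting.models_axioms_iff M).2 ⟨(CoHeyting.models_V3_iff M).1 h.1,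
      CoHeyting.density_of_isExistentiallyClosed h, CoHeyting.splitting_of_isExistentiallyClosed h⟩
  · obtain @⟨M, SM, hM, _⟩ := M
    obtain @⟨N, SN, hN, _⟩ := N
    obtain ⟨_, rfl⟩ := CoHeyting.exists_coheyting M
      (CoHeyting.model_V1_of_V3 M (Theory.Model.mono hM Set.subset_union_left))
    obtain ⟨_, rfl⟩ := CoHeyting.exists_coheyting N
      (CoHeyting.model_V1_of_V3 N (Theory.Model.mono hN Set.subset_union_left))
    refine CoHeyting.SameEquations.realize_iff φ ((CoHeyting.models_axioms_iff M).1 hM)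
      ((CoHeyting.models_axioms_iff N).1 hN) v w default default fun s t => ?_
    -- With no bound variables present, an equation between terms is itself a quantifier-free
    -- formula in the free variables.
    exact h (BoundedFormula.equal s t) (BoundedFormula.IsAtomic.equal _ _).isQF
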